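/- **Setting.** Let $\mathcal{Y}$ be a finite label set with a metric $d$, let $C_M=\max_{i,j\in\mathcal{Y}}d(i,j)$ be the maximal transport cost between labels, and let $\Delta^{\mathcal{Y}}$ be the set of probability vectors on $\mathcal{Y}$. For $\mu,\nu\in\Delta^{\mathcal{Y}}$ let $D(\mu,\nu)=\min_{\pi}\sum_{i,j}\pi_{ij}\,d(i,j)$ be the (unregularized) 1-Wasserstein distance, where $\pi$ ranges over the nonnegative matrices with row sums $\mu$ and column sums $\nu$. Let $P$ be a probability measure on a measurable space $\mathcal{X}$, let $(h_k)_{k\in\mathcal{K}}$ be a finite family of measurable maps $h_k:\mathcal{X}\to\Delta^{\mathcal{Y}}$ (the local models), and let $W_k:\Delta^{\mathcal{Y}}\to[0,\infty)$, $k\in\mathcal{K}$, be measurable weight functions, for instance the $L^2$ confidence $W_k(p)=\|p-B_k\|_2$ with respect to a bias vector $B_k$, or $W_k\equiv 1$. The distillation loss of $q\in\Delta^{\mathcal{Y}}$ against $p=(p_k)_{k\in\mathcal{K}}$ is the weighted sum, with normalized weights, $$\mathcal{L}(q,p)=\sum_{k\in\mathcal{K}}\frac{W_k(p_k)}{\sum_{j\in\mathcal{K}}W_j(p_j)}\,D(q,p_k)$$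 (read as $0$ if all the weights vanish). Write $h_{\mathcal{K}}(x)=(h_k(x))_{k\in\mathcal{K}}$. Let $\mathcal{H}_g^o$ be a class of measurable maps $\mathcal{X}\to\mathbb{R}^{\mathcal{Y}}$ that has a countable subclass such that every member of $\mathcal{H}_g^o$ is a pointwise limit of a sequence in the subclass (this is automatic if $\mathcal{X}$ is countable), and let $\mathcal{H}_g=\{\mathfrak{s}\circ h: h\in\mathcal{H}_g^o\}$, where $\mathfrak{s}$ is the softmax. For a class $G$ of real functions on $\mathcal{X}$ let $\mathfrak{R}_N(G)=\mathbb{E}_{S}\,\mathbb{E}_\sigma\sup_{f\in G}\frac1N\sum_{i=1}^N\sigma_i f(x^{(i)})$ be its Rademacher complexity, where $S=(x^{(1)},\dots,x^{(N)})$ is an i.i.d. sample from $P$ and $\sigma_1,\dots,\sigma_N$ are independent uniform signs, and put $\mathfrak{R}_N(\mathcal{H}_g^o)=\max_{l\in\mathcal{Y}}\mathfrak{R}_N(\{x\mapsto h(x)_l : h\in\mathcal{H}_g^o\})\in[0,\infty]$. **Theorem.** For every $N\ge1$ and every $\delta>0$, with probability at least $1-\delta$ over the i.i.d. sample $S$ from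 $P$, every minimizer $h_{\hat\theta}$ over $\mathcal{H}_g$ of the empirical loss $\hat{\mathbb{E}}[\mathcal{L}(h(x),h_{\mathcal{K}}(x))]=\frac1N\sum_{i=1}^N\mathcal{L}(h(x^{(i)}),h_{\mathcal{K}}(x^{(i)}))$ satisfies $$\mathbb{E}_{x\sim P}\big[\mathcal{L}(h_{\hat\theta}(x),h_{\mathcal{K}}(x))\big]\le\inf_{h\in\mathcal{H}_g}\hat{\mathbb{E}}\big[\mathcal{L}(h(x),h_{\mathcal{K}}(x))\big]+32\,|\mathcal{Y}|\,C_M\,\mathfrak{R}_N(\mathcal{H}_g^o)+2\,C_M\,|\mathcal{Y}|\sqrt{|\mathcal{Y}|\,\frac{\log(1/\delta)}{2N}} .$$ (For $\delta\ge1$ there is nothing to show.) -/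

import Mathlib

open MeasureTheory Filter Topology

noncomputable section

namespace Distill

/-- Softmax of a vector of logits. -/
def softmax {Y : Type*} [Fintype Y] (v : Y → ℝ) : Y → ℝ :=
  fun l => Real.exp (v l) / ∑ j, Real.exp (v j)

/-- Transport plans between two weight vectors on the label space: nonnegative matrices with
row sums `μ` and column sums `ν`. -/
def transportPlans {Y : Type*} [Fintype Y] (μ ν : Y → ℝ) : Set (Y → Y → ℝ) :=
  {π | (∀ i j, 0 ≤ π i j) ∧ (∀ i, ∑ j, π i j = μ i) ∧ (∀ j, ∑ i, π i j = ν j)}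

/-- Unregularized 1-Wasserstein distance between probability vectors on a finite metric space:
the least cost of a transport plan, the cost of moving unit mass from `i` to `j` being
`dist i j`. -/
def wasserstein1 {Y : Type*} [Fintype Y] [MetricSpace Y] (μ ν : Y → ℝ) : ℝ :=
  ⨅ π : transportPlans μ ν, ∑ i, ∑ j, π.1 i j * dist i j

/-- The maximal transport cost between labels. -/
def maxCost (Y : Type*) [Fintype Y] [MetricSpace Y] : ℝ :=
  ⨆ p : Y × Y, dist p.1 p.2

/-- The Euclidean confidence score: distance of a prediction `p` from the probability bias `B`. -/
def l2Confidence {Y : Type*} [Fintype Y] (B p : Y → ℝ) : ℝ :=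
  Real.sqrt (∑ l, (p l - B l) ^ 2)

theorem l2Confidence_nonneg {Y : Type*} [Fintype Y] (B p : Y → ℝ) : 0 ≤ l2Confidence B p :=
  Real.sqrt_nonneg _

theorem measurable_l2Confidence {Y : Type*} [Fintype Y] (B : Y → ℝ) :
    Measurable (l2Confidence B) := by
  unfold l2Confidence
  fun_prop

/-- Normalized weight of the `k`-th local model, where `p k` is its prediction and `W k` its
weight function. If all the weights vanish, so do the normalized ones. -/
def normalizedWeight {Y K : Type*} [Fintype K] (W : K → (Y → ℝ) → ℝ) (p : K → Y → ℝ) (k : K) : ℝ :=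
  W k (p k) / ∑ j, W j (p j)

/-- The weighted distillation loss of a prediction `q` of the global model against the
predictions `p k` of the local models. -/
def loss {Y K : Type*} [Fintype Y] [MetricSpace Y] [Fintype K]
    (W : K → (Y → ℝ) → ℝ) (q : Y → ℝ) (p : K → Y → ℝ) : ℝ :=
  ∑ k, normalizedWeight W p k * wasserstein1 q (p k)

/-- Expected loss of the global hypothesis `g` against the local hypotheses `hloc`. -/
def risk {X Y K : Type*} [MeasurableSpace X] [Fintype Y] [MetricSpace Y] [Fintype K]
    (P : Measure X) (W : K → (Y → ℝ) → ℝ) (hloc : K → X → Y → ℝ) (g : X → Y → ℝ) : ℝ :=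
  ∫ x, loss W (g x) (fun k => hloc k x) ∂P

/-- Empirical loss of the global hypothesis `g` on the sample `S`. -/
def empiricalRisk {X Y K : Type*} [Fintype Y] [MetricSpace Y] [Fintype K] {N : ℕ}
    (S : Fin N → X) (W : K → (Y → ℝ) → ℝ) (hloc : K → X → Y → ℝ) (g : X → Y → ℝ) : ℝ :=
  (1 / (N : ℝ)) * ∑ i, loss W (g (S i)) (fun k => hloc k (S i))

/-- The global hypothesis class: softmax composed with the logit maps in `Ho`. -/
def globalClass {X Y : Type*} [Fintype Y] (Ho : Set (X → Y → ℝ)) : Set (X → Y → ℝ) :=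
  (fun h x => softmax (h x)) '' Ho

/-- `g` minimizes the empirical loss on the sample `S` over the global class. -/
def IsEmpiricalRiskMinimizer {X Y K : Type*} [Fintype Y] [MetricSpace Y] [Fintype K] {N : ℕ}
    (S : Fin N → X) (W : K → (Y → ℝ) → ℝ) (hloc : K → X → Y → ℝ) (Ho : Set (X → Y → ℝ))
    (g : X → Y → ℝ) : Prop :=
  g ∈ globalClass Ho ∧
    ∀ g' ∈ globalClass Ho, empiricalRisk S W hloc g ≤ empiricalRisk S W hloc g'

/-- Empirical Rademacher complexity of a real-valued class on a fixed sample: the average, over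
all sign vectors, of the supremum of the signed empirical means. It lives in the extended reals,
since the supremum is infinite when the class is unbounded on the sample. -/
def empiricalRademacher {X : Type*} {N : ℕ} (S : Fin N → X) (G : Set (X → ℝ)) : EReal :=
  (((2 : ℝ) ^ N)⁻¹ : ℝ) *
    ∑ σ : Fin N → ℤˣ, ⨆ g ∈ G, (((1 / (N : ℝ)) * ∑ i, ((σ i : ℤ) : ℝ) * g (S i) : ℝ) : EReal)

/-- Rademacher complexity of a real-valued class: expectation of the empirical one (which is
nonnegative for a nonempty class) over `N` independent samples from `P`. -/
def rademacher {X : Type*} [MeasurableSpace X] (P : Measure X) (N : ℕ) (G : Set (X → ℝ)) :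
    ENNReal :=
  ∫⁻ S : Fin N → X, (empiricalRademacher S G).toENNReal ∂(Measure.pi fun _ => P)

/-- Rademacher complexity of a class of logit maps: the largest Rademacher complexity of the
real-valued classes of its logits, one class for each label. -/
def logitRademacher {X Y : Type*} [MeasurableSpace X] (P : Measure X) (N : ℕ)
    (Ho : Set (X → Y → ℝ)) : ENNReal :=
  ⨆ l : Y, rademacher P N ((fun h x => h x l) '' Ho)

/-- Pointwise separability, the usual condition under which suprema over a class of functions are
measurable: a countable subclass is sequentially dense for pointwise convergence. Every class of
functions on a countable space satisfies it. -/
def PointwiseSeparable {X Y : Type*} (Ho : Set (X → Y → ℝ)) : Prop :=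
  ∃ H₀ : Set (X → Y → ℝ), H₀ ⊆ Ho ∧ H₀.Countable ∧
    ∀ h ∈ Ho, ∃ u : ℕ → X → Y → ℝ, (∀ n, u n ∈ H₀) ∧
      ∀ x, Tendsto (fun n => u n x) atTop (𝓝 (h x))

end Distill

end

open MeasureTheory Filter Topology

namespace Distill

/-! ### Transport plans: existence, comparison and measurability of the Wasserstein distance. -/

section Transport

variable {Y : Type*} [Fintype Y]

/-! The heart is a one-sided uniform deviation bound (`exists_uniform_deviation`): off an event of
probability at most `δ`, every softmax hypothesis has risk at most its empirical risk plus `4 * |Y|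
* C * R + C * √(log (1/δ) / (2 * N))`, where `C` is the maximal cost and `R` the logit complexity.
For a minimizer the empirical risk is the infimum, and the constants of the theorem are larger.

The loss is `2 * C`-Lipschitz in the logits for the sup norm. Moving the logits from `w` to `v`
keeps at least the fraction `a = exp (-2 * ‖v - w‖)` of each probability. Hence an optimal plan for
`softmax w`, scaled by `a`, can be completed to a plan for `softmax v`, and only the mass `1 - a ≤ 2
* ‖v - w‖` pays extra, at most `C` per unit (`wasserstein1_softmax_le`). The normalized weights do
not involve the global prediction, so the loss inherits the bound.

The rest is empirical process theory for losses with values in `[0, C]`. McDiarmid's inequality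
concentrates the largest deviation around its mean. Symmetrization bounds this mean by twice a
Rademacher average of the losses (`integral_deviationSup_le`). A contraction principle for the sup
norm replaces the losses by the logits, with factor `2 * C` and one term per label
(`expect_iSup_sign_sum_le_sum`). Suprema are taken over the countable subclass, where they are
measurable; pointwise limits carry the bound to the whole class. -/

theorem product_mem_transportPlans {μ ν : Y → ℝ} (hμ : ∀ i, 0 ≤ μ i) (hμ1 : ∑ i, μ i = 1)
    (hν : ν ∈ stdSimplex ℝ Y) : (fun i j => μ i * ν j) ∈ transportPlans μ ν := by
  refine ⟨fun i j => mul_nonneg (hμ i) (hν.1 j), fun i => ?_, fun j => ?_⟩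
  · rw [← Finset.mul_sum, hν.2, mul_one]
  · rw [← Finset.sum_mul, hμ1, one_mul]

theorem isCompact_transportPlans (μ ν : Y → ℝ) : IsCompact (transportPlans μ ν) := by
  refine IsCompact.of_isClosed_subset
    (isCompact_univ_pi fun i => isCompact_univ_pi fun _ : Y => isCompact_Icc (a := 0) (b := μ i))
    ?_ ?_
  · simp only [transportPlans, Set.ofPred_and, Set.ofPred_forall]
    refine IsClosed.inter ?_ (IsClosed.inter ?_ ?_)
    · exact isClosed_iInter fun i => isClosed_iInter fun j =>
        isClosed_le continuous_const (by fun_prop)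
    · exact isClosed_iInter fun i => isClosed_eq (by fun_prop) continuous_const
    · exact isClosed_iInter fun i => isClosed_eq (by fun_prop) continuous_const
  · intro π hπ i _ j _
    refine ⟨hπ.1 i j, ?_⟩
    rw [← hπ.2.1 i]
    exact Finset.single_le_sum (fun j _ => hπ.1 i j) (Finset.mem_univ j)

variable [MetricSpace Y]

theorem dist_le_maxCost (i j : Y) : dist i j ≤ maxCost Y :=
  le_ciSup (f := fun p : Y × Y => dist p.1 p.2) (Set.finite_range _).bddAbove (i, j)

theorem maxCost_nonneg : 0 ≤ maxCost Y :=
  Real.iSup_nonneg fun _ => dist_nonneg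

theorem transportCost_nonneg {μ ν : Y → ℝ} {π : Y → Y → ℝ} (hπ : π ∈ transportPlans μ ν) :
    0 ≤ ∑ i, ∑ j, π i j * dist i j :=
  Finset.sum_nonneg fun i _ => Finset.sum_nonneg fun j _ => mul_nonneg (hπ.1 i j) dist_nonneg

theorem wasserstein1_nonneg (μ ν : Y → ℝ) : 0 ≤ wasserstein1 μ ν :=
  Real.iInf_nonneg fun π => transportCost_nonneg π.2

theorem wasserstein1_le {μ ν : Y → ℝ} {π : Y → Y → ℝ} (hπ : π ∈ transportPlans μ ν) :
    wasserstein1 μ ν ≤ ∑ i, ∑ j, π i j * dist i j :=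
  ciInf_le (f := fun π : transportPlans μ ν => ∑ i, ∑ j, π.1 i j * dist i j)
    ⟨0, by rintro _ ⟨π, rfl⟩; exact transportCost_nonneg π.2⟩ ⟨π, hπ⟩

/-- The total mass of a probability vector times the maximal cost bounds the cost of a plan. -/
theorem transportCost_le {μ ν : Y → ℝ} {π : Y → Y → ℝ} (hπ : π ∈ transportPlans μ ν) :
    ∑ i, ∑ j, π i j * dist i j ≤ (∑ i, μ i) * maxCost Y := by
  rw [Finset.sum_mul]
  refine Finset.sum_le_sum fun i _ => ?_
  rw [← hπ.2.1 i, Finset.sum_mul]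
  exact Finset.sum_le_sum fun j _ => mul_le_mul_of_nonneg_left (dist_le_maxCost i j) (hπ.1 i j)

theorem wasserstein1_le_maxCost {μ ν : Y → ℝ} (hμ : μ ∈ stdSimplex ℝ Y)
    (hν : ν ∈ stdSimplex ℝ Y) : wasserstein1 μ ν ≤ maxCost Y := by
  have h := product_mem_transportPlans hμ.1 hμ.2 hν
  simpa [hμ.2] using (wasserstein1_le h).trans (transportCost_le h)

/-- If `q` dominates the fraction `a` of `q'`, then a plan for `q'` yields one for `q` that
spreads the excess independently, at an extra cost of at most `(1 - a) * maxCost Y`. -/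
theorem wasserstein1_le_add_of_mul_le {q q' p : Y → ℝ} (hq : q ∈ stdSimplex ℝ Y)
    (hq' : q' ∈ stdSimplex ℝ Y) (hp : p ∈ stdSimplex ℝ Y) {a : ℝ} (ha0 : 0 ≤ a) (ha1 : a ≤ 1)
    (h : ∀ i, a * q' i ≤ q i) :
    wasserstein1 q p ≤ wasserstein1 q' p + (1 - a) * maxCost Y := by
  rw [← sub_le_iff_le_add]
  have : Nonempty (transportPlans q' p) := ⟨⟨_, product_mem_transportPlans hq'.1 hq'.2 hp⟩⟩
  refine le_ciInf fun ⟨π, hπ⟩ => ?_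
  have hplan : (fun i j => a * π i j + (q i - a * q' i) * p j) ∈ transportPlans q p := by
    refine ⟨fun i j => add_nonneg (mul_nonneg ha0 (hπ.1 i j))
      (mul_nonneg (sub_nonneg.2 (h i)) (hp.1 j)), fun i => ?_, fun j => ?_⟩
    · rw [Finset.sum_add_distrib, ← Finset.mul_sum, ← Finset.mul_sum, hπ.2.1, hp.2]; ring
    · rw [Finset.sum_add_distrib, ← Finset.mul_sum, ← Finset.sum_mul, hπ.2.2,
        Finset.sum_sub_distrib, ← Finset.mul_sum, hq.2, hq'.2]; ring
  -- The excess is itself a plan, from `q - a * q'` to `(1 - a) * p`, of total mass `1 - a`.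
  have hexcess : ∑ i, ∑ j, (q i - a * q' i) * p j * dist i j ≤ (1 - a) * maxCost Y := by
    have := transportCost_le (μ := fun i => q i - a * q' i) (ν := fun j => (1 - a) * p j)
      (π := fun i j => (q i - a * q' i) * p j) ⟨fun i j =>
      (mul_nonneg (sub_nonneg.2 (h i)) (hp.1 j)), fun i => by
        rw [← Finset.mul_sum, hp.2, mul_one], fun j => by
        rw [← Finset.sum_mul, Finset.sum_sub_distrib, ← Finset.mul_sum, hq.2, hq'.2, mul_one]⟩
    rwa [Finset.sum_sub_distrib, ← Finset.mul_sum, hq.2, hq'.2, mul_one] at this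
  have hcost : ∑ i, ∑ j, (a * π i j + (q i - a * q' i) * p j) * dist i j
      = a * ∑ i, ∑ j, π i j * dist i j + ∑ i, ∑ j, (q i - a * q' i) * p j * dist i j := by
    simp only [Finset.mul_sum, ← Finset.sum_add_distrib]
    exact Finset.sum_congr rfl fun i _ => Finset.sum_congr rfl fun j _ => by ring
  have h1 := wasserstein1_le hplan
  have h2 := mul_le_of_le_one_left (transportCost_nonneg hπ) ha1
  rw [hcost] at h1
  change _ ≤ ∑ i, ∑ j, π i j * dist i j
  linarith

theorem exists_plan_eq_wasserstein1 {μ ν : Y → ℝ} (hμ : μ ∈ stdSimplex ℝ Y)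
    (hν : ν ∈ stdSimplex ℝ Y) :
    ∃ π ∈ transportPlans μ ν, ∑ i, ∑ j, π i j * dist i j = wasserstein1 μ ν := by
  obtain ⟨π, hπ, hmin⟩ := (isCompact_transportPlans μ ν).exists_isMinOn
    ⟨_, product_mem_transportPlans hμ.1 hμ.2 hν⟩
    (f := fun π => ∑ i, ∑ j, π i j * dist i j) (by fun_prop)
  have : Nonempty (transportPlans μ ν) := ⟨⟨π, hπ⟩⟩
  exact ⟨π, hπ, le_antisymm (le_ciInf fun π' => hmin π'.2) (wasserstein1_le hπ)⟩

/-- The pairs of marginals of plans of unit mass and cost at most `c`. -/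
theorem isCompact_marginals (c : ℝ) :
    IsCompact ((fun π : Y → Y → ℝ => ((fun i => ∑ j, π i j), fun j => ∑ i, π i j)) ''
      {π | (∀ i j, 0 ≤ π i j) ∧ ∑ i, ∑ j, π i j = 1 ∧ ∑ i, ∑ j, π i j * dist i j ≤ c}) := by
  refine IsCompact.image ?_ (by fun_prop)
  refine IsCompact.of_isClosed_subset
    (isCompact_univ_pi fun _ : Y => isCompact_univ_pi fun _ : Y =>
      isCompact_Icc (a := (0 : ℝ)) (b := 1)) ?_ ?_
  · simp only [Set.ofPred_and, Set.ofPred_forall]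
    refine IsClosed.inter ?_ (IsClosed.inter ?_ ?_)
    · exact isClosed_iInter fun i => isClosed_iInter fun j =>
        isClosed_le continuous_const (by fun_prop)
    · exact isClosed_eq (by fun_prop) continuous_const
    · exact isClosed_le (by fun_prop) continuous_const
  · intro π hπ i _ j _
    refine ⟨hπ.1 i j, ?_⟩
    rw [← hπ.2.1]
    exact (Finset.single_le_sum (fun j _ => hπ.1 i j) (Finset.mem_univ j)).trans
      (Finset.single_le_sum (f := fun i => ∑ j, π i j)
        (fun i _ => Finset.sum_nonneg fun j _ => hπ.1 i j) (Finset.mem_univ i))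

/-- Since optimal plans exist, a sublevel set is the preimage under `(q, p)` of the compact set in
`isCompact_marginals`. -/
theorem measurable_wasserstein1 {X : Type*} [MeasurableSpace X] {q p : X → Y → ℝ}
    (hq : Measurable q) (hp : Measurable p) (hq1 : ∀ x, q x ∈ stdSimplex ℝ Y)
    (hp1 : ∀ x, p x ∈ stdSimplex ℝ Y) : Measurable fun x => wasserstein1 (q x) (p x) := by
  refine measurable_of_Iic fun c => ?_
  convert (hq.prodMk hp) (isCompact_marginals (Y := Y) c).measurableSet using 1
  ext x
  simp only [Set.mem_preimage, Set.mem_Iic, Set.mem_image, Set.mem_ofPred_eq, Prod.mk.injEq]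
  constructor
  · intro hx
    obtain ⟨π, hπ, h⟩ := exists_plan_eq_wasserstein1 (hq1 x) (hp1 x)
    exact ⟨π, ⟨hπ.1, by simp only [hπ.2.1, (hq1 x).2], h.trans_le hx⟩,
      funext hπ.2.1, funext hπ.2.2⟩
  · rintro ⟨π, ⟨h0, -, hc⟩, h1, h2⟩
    exact (wasserstein1_le ⟨h0, congrFun h1, congrFun h2⟩).trans hc

end Transport

/-! ### Softmax and the Lipschitz dependence of the transport cost on the logits. -/

section Softmax

variable {Y : Type*} [Fintype Y]

theorem softmax_mem_stdSimplex [Nonempty Y] (v : Y → ℝ) : softmax v ∈ stdSimplex ℝ Y := by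
  have h : 0 < ∑ j, Real.exp (v j) :=
    Finset.sum_pos (fun _ _ => Real.exp_pos _) Finset.univ_nonempty
  refine ⟨fun i => div_nonneg (Real.exp_pos _).le h.le, ?_⟩
  simp only [softmax]
  rw [← Finset.sum_div, div_self h.ne']

theorem measurable_softmax : Measurable (softmax (Y := Y)) := by
  unfold softmax
  fun_prop

/-- The numerator and the normalizing sum each change by a factor of at most `exp ‖v - w‖`; hence
the `2`. -/
theorem exp_mul_softmax_le [Nonempty Y] (v w : Y → ℝ) (i : Y) :
    Real.exp (-(2 * ‖v - w‖)) * softmax w i ≤ softmax v i := by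
  have hpos : ∀ u : Y → ℝ, 0 < ∑ j, Real.exp (u j) := fun u =>
    Finset.sum_pos (fun _ _ => Real.exp_pos _) Finset.univ_nonempty
  have hdist : ∀ j, |v j - w j| ≤ ‖v - w‖ := fun j => norm_le_pi_norm (v - w) j
  have h1 : Real.exp (-‖v - w‖) * Real.exp (w i) ≤ Real.exp (v i) := by
    rw [← Real.exp_add, Real.exp_le_exp]
    linarith [(abs_le.1 (hdist i)).1]
  have h2 : Real.exp (-‖v - w‖) * ∑ j, Real.exp (v j) ≤ ∑ j, Real.exp (w j) := by
    rw [Finset.mul_sum]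
    refine Finset.sum_le_sum fun j _ => ?_
    rw [← Real.exp_add, Real.exp_le_exp]
    linarith [(abs_le.1 (hdist j)).2]
  have h3 : Real.exp (-(2 * ‖v - w‖)) = Real.exp (-‖v - w‖) * Real.exp (-‖v - w‖) := by
    rw [← Real.exp_add]; ring_nf
  simp only [softmax]
  rw [← mul_div_assoc, div_le_div_iff₀ (hpos w) (hpos v), h3]
  calc Real.exp (-‖v - w‖) * Real.exp (-‖v - w‖) * Real.exp (w i) * ∑ j, Real.exp (v j)
      = (Real.exp (-‖v - w‖) * Real.exp (w i)) * (Real.exp (-‖v - w‖) * ∑ j, Real.exp (v j)) := by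
        ring
    _ ≤ Real.exp (v i) * ∑ j, Real.exp (w j) :=
        mul_le_mul h1 h2 (mul_nonneg (Real.exp_pos _).le (hpos v).le) (Real.exp_pos _).le

theorem wasserstein1_softmax_le [Nonempty Y] [MetricSpace Y] (v w : Y → ℝ) {p : Y → ℝ}
    (hp : p ∈ stdSimplex ℝ Y) :
    wasserstein1 (softmax v) p ≤ wasserstein1 (softmax w) p + 2 * maxCost Y * ‖v - w‖ := by
  refine (wasserstein1_le_add_of_mul_le (softmax_mem_stdSimplex v) (softmax_mem_stdSimplex w) hp
    (Real.exp_pos _).le (Real.exp_le_one_iff.2 (by simp)) (exp_mul_softmax_le v w)).trans ?_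
  have := Real.add_one_le_exp (-(2 * ‖v - w‖))
  nlinarith [maxCost_nonneg (Y := Y)]

end Softmax

/-! ### Bounds, Lipschitz continuity and measurability of the loss. -/

section Loss

variable {Y K : Type*} [Fintype K] {W : K → (Y → ℝ) → ℝ} {p : K → Y → ℝ}

theorem normalizedWeight_nonneg (hW : ∀ k, 0 ≤ W k (p k)) (k : K) :
    0 ≤ normalizedWeight W p k :=
  div_nonneg (hW k) (Finset.sum_nonneg fun j _ => hW j)

/-- Only an inequality, because the sum is `0` when the total weight vanishes. -/
theorem sum_normalizedWeight_le_one : ∑ k, normalizedWeight W p k ≤ 1 := by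
  simp only [normalizedWeight]
  rw [← Finset.sum_div]
  exact div_self_le_one _

theorem sum_normalizedWeight_mul_le (hW : ∀ k, 0 ≤ W k (p k)) {f : K → ℝ} {C : ℝ} (hC : 0 ≤ C)
    (hf : ∀ k, f k ≤ C) : ∑ k, normalizedWeight W p k * f k ≤ C :=
  calc ∑ k, normalizedWeight W p k * f k ≤ ∑ k, normalizedWeight W p k * C :=
        Finset.sum_le_sum fun k _ => mul_le_mul_of_nonneg_left (hf k) (normalizedWeight_nonneg hW k)
    _ = (∑ k, normalizedWeight W p k) * C := by rw [Finset.sum_mul]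
    _ ≤ C := mul_le_of_le_one_left hC sum_normalizedWeight_le_one

variable [Fintype Y] [MetricSpace Y]

theorem loss_nonneg (hW : ∀ k, 0 ≤ W k (p k)) (q : Y → ℝ) : 0 ≤ loss W q p :=
  Finset.sum_nonneg fun k _ => mul_nonneg (normalizedWeight_nonneg hW k) (wasserstein1_nonneg _ _)

theorem loss_le_maxCost (hW : ∀ k, 0 ≤ W k (p k)) (hp : ∀ k, p k ∈ stdSimplex ℝ Y) {q : Y → ℝ}
    (hq : q ∈ stdSimplex ℝ Y) : loss W q p ≤ maxCost Y :=
  sum_normalizedWeight_mul_le hW maxCost_nonneg fun k => wasserstein1_le_maxCost hq (hp k)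

theorem abs_loss_softmax_sub_le [Nonempty Y] (hW : ∀ k, 0 ≤ W k (p k))
    (hp : ∀ k, p k ∈ stdSimplex ℝ Y) (v w : Y → ℝ) :
    |loss W (softmax v) p - loss W (softmax w) p| ≤ 2 * maxCost Y * ‖v - w‖ := by
  have key : ∀ v w : Y → ℝ,
      loss W (softmax v) p - loss W (softmax w) p ≤ 2 * maxCost Y * ‖v - w‖ := by
    intro v w
    simp only [loss]
    rw [← Finset.sum_sub_distrib]
    simp only [← mul_sub]
    refine sum_normalizedWeight_mul_le hW
      (mul_nonneg (mul_nonneg two_pos.le maxCost_nonneg) (norm_nonneg _)) fun k => ?_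
    linarith [wasserstein1_softmax_le v w (hp k)]
  rw [abs_le]
  have h1 := key v w
  have h2 := key w v
  rw [norm_sub_rev] at h2
  exact ⟨by linarith, h1⟩

theorem measurable_loss {X : Type*} [MeasurableSpace X] {q : X → Y → ℝ} {h : K → X → Y → ℝ}
    (hW : ∀ k, Measurable (W k)) (hq : Measurable q) (hh : ∀ k, Measurable (h k))
    (hq1 : ∀ x, q x ∈ stdSimplex ℝ Y) (hh1 : ∀ k x, h k x ∈ stdSimplex ℝ Y) :
    Measurable fun x => loss W (q x) fun k => h k x := by
  simp only [loss, normalizedWeight]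
  refine Finset.measurable_sum _ fun k _ => Measurable.mul (Measurable.div ?_ ?_)
    (measurable_wasserstein1 hq (hh k) hq1 (hh1 k))
  · exact (hW k).comp (hh k)
  · exact Finset.measurable_sum _ fun j _ => (hW j).comp (hh j)

end Loss

/-! ### Vector contraction for Rademacher averages. -/

section Contraction

open Finset
open scoped BigOperators

theorem expect_units_int (F : ℤˣ → ℝ) : 𝔼 s, F s = (F 1 + F (-1)) / 2 := by
  rw [Fintype.expect_eq_sum_div_card]
  simp

theorem units_int_cast_mul_self (s : ℤˣ) : ((s : ℤ) : ℝ) * ((s : ℤ) : ℝ) = 1 := by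
  rcases Int.units_eq_one_or s with rfl | rfl <;> simp

theorem abs_units_int_cast (s : ℤˣ) : |((s : ℤ) : ℝ)| = 1 := by
  rcases Int.units_eq_one_or s with rfl | rfl <;> simp

theorem bddAbove_range_of_abs_le {ι : Type*} {f : ι → ℝ} {M : ℝ} (h : ∀ t, |f t| ≤ M) :
    BddAbove (Set.range f) :=
  ⟨M, by rintro _ ⟨t, rfl⟩; exact (le_abs_self _).trans (h t)⟩

theorem abs_sum_sign_mul_le {ι : Type*} [Fintype ι] {f : ι → ℝ} {M : ℝ} (s : ι → ℤˣ)
    (h : ∀ i, |f i| ≤ M) : |∑ i, ((s i : ℤ) : ℝ) * f i| ≤ Fintype.card ι * M := by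
  refine (Finset.abs_sum_le_sum_abs _ _).trans ?_
  calc ∑ i, |((s i : ℤ) : ℝ) * f i| ≤ ∑ _i : ι, M :=
        Finset.sum_le_sum fun i _ => by rw [abs_mul, abs_units_int_cast, one_mul]; exact h i
    _ = _ := by simp

theorem expect_mul_left_eq {G : Type*} [Group G] [Fintype G] (g : G) (F : G → ℝ) :
    𝔼 x, F (g * x) = 𝔼 x, F x :=
  Fintype.expect_equiv (Equiv.mulLeft g) _ _ fun _ => rfl

/-- A coordinate of a uniform sign vector is uncorrelated with the others. -/
theorem expect_sign_mul_sum {Y : Type*} [Fintype Y] [DecidableEq Y] (v : Y → ℝ) (l : Y) :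
    𝔼 ε : Y → ℤˣ, ((ε l : ℤ) : ℝ) * ∑ j, ((ε j : ℤ) : ℝ) * v j = v l := by
  simp only [Finset.mul_sum]
  rw [Finset.expect_sum_comm, Finset.sum_eq_single l]
  · simp only [← mul_assoc, units_int_cast_mul_self, one_mul]
    exact Fintype.expect_const _
  · intro j _ hj
    -- Flipping the sign at `j` negates the product, so its mean equals its own negative.
    have h := expect_mul_left_eq (Pi.mulSingle j (-1) : Y → ℤˣ)
      (fun ε => ((ε l : ℤ) : ℝ) * (((ε j : ℤ) : ℝ) * v j))
    simp only [Pi.mul_apply, Pi.mulSingle_eq_same, Pi.mulSingle_eq_of_ne' hj, one_mul, neg_mul,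
      Units.val_neg, Int.cast_neg, mul_neg, Finset.expect_neg_distrib] at h
    linarith
  · simp

/-- Each column of a uniform sign matrix is a uniform sign vector. -/
theorem expect_sign_column {I Y : Type*} [Fintype I] [Fintype Y] [DecidableEq I] [DecidableEq Y]
    (l : Y) (G : (I → ℤˣ) → ℝ) :
    𝔼 ε : I → Y → ℤˣ, G (fun i => ε i l) = 𝔼 σ : I → ℤˣ, G σ :=
  calc 𝔼 ε : I → Y → ℤˣ, G (fun i => ε i l)
      = 𝔼 τ : I → ℤˣ, 𝔼 ε : I → Y → ℤˣ, G (τ * fun i => ε i l) := by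
        -- An auxiliary sign vector `τ` multiplies the rows of `ε` without changing its law; for
        -- fixed `ε`, the column is then absorbed into `τ`.
        rw [← Fintype.expect_const (ι := I → ℤˣ) (𝔼 ε : I → Y → ℤˣ, G (fun i => ε i l))]
        refine Finset.expect_congr rfl fun τ _ => ?_
        exact (expect_mul_left_eq (fun i (_ : Y) => τ i) (fun ε => G fun i => ε i l)).symm
    _ = 𝔼 ε : I → Y → ℤˣ, 𝔼 τ : I → ℤˣ, G ((fun i => ε i l) * τ) := by
        rw [Finset.expect_comm]
        simp only [mul_comm]
    _ = 𝔼 _ε : I → Y → ℤˣ, 𝔼 τ : I → ℤˣ, G τ :=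
        Finset.expect_congr rfl fun ε _ => expect_mul_left_eq _ G
    _ = _ := Fintype.expect_const _

variable {ι Y : Type*} [Nonempty ι] [Fintype Y] [Nonempty Y] [DecidableEq Y]

/-- Contraction in a single sample point: a random sign times a function that is Lipschitz for the
sup norm is replaced by independent random signs of the coordinates. -/
theorem expect_iSup_sign_mul_le {B φ : ι → ℝ} {a : ι → Y → ℝ} {L M : ℝ} (hL : 0 ≤ L)
    (hB : ∀ t, |B t| ≤ M) (ha : ∀ t l, |a t l| ≤ M)
    (hlip : ∀ t t', |φ t - φ t'| ≤ L * ‖a t - a t'‖) :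
    𝔼 s : ℤˣ, ⨆ t, (B t + ((s : ℤ) : ℝ) * φ t)
      ≤ 𝔼 ε : Y → ℤˣ, ⨆ t, (B t + L * ∑ l, ((ε l : ℤ) : ℝ) * a t l) := by
  set Ψ : (Y → ℤˣ) → ℝ := fun ε => ⨆ t, (B t + L * ∑ l, ((ε l : ℤ) : ℝ) * a t l) with hΨ
  have hle : ∀ ε t, B t + L * ∑ l, ((ε l : ℤ) : ℝ) * a t l ≤ Ψ ε := fun ε t =>
    le_ciSup (f := fun t => B t + L * ∑ l, ((ε l : ℤ) : ℝ) * a t l)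
      (bddAbove_range_of_abs_le (M := M + L * (Fintype.card Y * M)) fun t =>
        (abs_add_le _ _).trans (add_le_add (hB t) (by
          rw [abs_mul, abs_of_nonneg hL]
          exact mul_le_mul_of_nonneg_left (abs_sum_sign_mul_le ε (ha t)) hL))) t
  -- Let `l` be a coordinate attaining `‖a t - a t'‖` and `s` the sign of the difference there.
  -- Testing `Ψ ε` and `Ψ (-ε)` at `t` and `t'`, in the order dictated by `s * ε l`, and averaging
  -- over `ε` kills all coordinates but `l` and leaves `L * ‖a t - a t'‖`.
  have hpair : ∀ t t', (B t + φ t) + (B t' - φ t') ≤ 2 * 𝔼 ε, Ψ ε := by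
    intro t t'
    obtain ⟨l, -, hl⟩ := Finset.exists_mem_eq_sup' Finset.univ_nonempty
      (fun l => |a t l - a t' l|)
    have hnorm : ‖a t - a t'‖ ≤ |a t l - a t' l| := by
      refine (pi_norm_le_iff_of_nonneg (abs_nonneg _)).2 fun j => ?_
      rw [← hl]
      exact Finset.le_sup' (fun l => |a t l - a t' l|) (Finset.mem_univ j)
    obtain ⟨s, hs⟩ : ∃ s : ℤˣ, |a t l - a t' l| = ((s : ℤ) : ℝ) * (a t l - a t' l) := by
      rcases abs_choice (a t l - a t' l) with h | h
      · exact ⟨1, by simpa using h⟩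
      · exact ⟨-1, by rw [h]; simp⟩
    have hneg : 𝔼 ε, Ψ ε = 𝔼 ε, Ψ (-ε) := (Finset.expect_equiv (Equiv.neg _) (by simp) (by simp))
    have hsum : ∀ ε : Y → ℤˣ, B t + B t' + L * ((s : ℤ) : ℝ) *
        (((ε l : ℤ) : ℝ) * ∑ j, ((ε j : ℤ) : ℝ) * (a t j - a t' j)) ≤ Ψ ε + Ψ (-ε) := by
      intro ε
      have e : ∀ u, ∑ j, (((-ε) j : ℤ) : ℝ) * a u j = -∑ j, ((ε j : ℤ) : ℝ) * a u j := fun u => by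
        rw [← Finset.sum_neg_distrib]
        exact Finset.sum_congr rfl fun j _ => by simp
      have h1 := hle ε t
      have h2 := hle (-ε) t'
      have h3 := hle ε t'
      have h4 := hle (-ε) t
      rw [e] at h2 h4
      simp only [mul_sub, Finset.sum_sub_distrib]
      rcases Int.units_eq_one_or s with rfl | rfl <;>
        rcases Int.units_eq_one_or (ε l) with h | h <;> rw [h] <;>
        simp only [Units.val_one, Int.cast_one, Units.val_neg, Int.cast_neg] <;> linarith
    have hexp : B t + B t' + L * |a t l - a t' l| ≤ 2 * 𝔼 ε, Ψ ε := by
      have := Finset.expect_le_expect (s := Finset.univ) fun ε _ => hsum ε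
      simp only [Finset.expect_add_distrib, Fintype.expect_const] at this
      rw [← Finset.mul_expect, expect_sign_mul_sum (fun j => a t j - a t' j), ← hneg, mul_assoc,
        ← hs] at this
      linarith
    have := (abs_le.1 (hlip t t')).2.trans (mul_le_mul_of_nonneg_left hnorm hL)
    linarith
  rw [expect_units_int]
  have h1 : ∀ t', ⨆ t, (B t + φ t) ≤ 2 * (𝔼 ε, Ψ ε) - (B t' - φ t') := fun t' =>
    ciSup_le fun t => le_sub_iff_add_le.2 (hpair t t')
  have h2 : ⨆ t, (B t - φ t) ≤ 2 * (𝔼 ε, Ψ ε) - ⨆ t, (B t + φ t) :=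
    ciSup_le fun t' => by linarith [h1 t']
  simp only [Units.val_one, Int.cast_one, Units.val_neg, Int.cast_neg, neg_mul, one_mul,
    ← sub_eq_add_neg]
  linarith

theorem expect_fin_succ {n : ℕ} {A : Type*} [Fintype A] (F : (Fin (n + 1) → A) → ℝ) :
    𝔼 σ, F σ = 𝔼 s : A, 𝔼 σ : Fin n → A, F (Fin.cons s σ) := by
  rw [← Finset.expect_product' Finset.univ Finset.univ fun s σ => F (Fin.cons s σ),
    Finset.univ_product_univ]
  exact (Fintype.expect_equiv (Fin.consEquiv fun _ => A) _ _ fun _ => rfl).symm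

/-- Vector contraction for Rademacher averages of functions that are Lipschitz for the sup
norm. -/
theorem expect_iSup_sign_sum_le {L C M : ℝ} (hL : 0 ≤ L) {n : ℕ} :
    ∀ {B : ι → ℝ} {φ : Fin n → ι → ℝ} {a : ι → Fin n → Y → ℝ} {D : ℝ}, (∀ t, |B t| ≤ D) →
    (∀ i t, |φ i t| ≤ C) → (∀ t i l, |a t i l| ≤ M) →
    (∀ i t t', |φ i t - φ i t'| ≤ L * ‖a t i - a t' i‖) →
    𝔼 σ : Fin n → ℤˣ, ⨆ t, (B t + ∑ i, ((σ i : ℤ) : ℝ) * φ i t)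
      ≤ 𝔼 ε : Fin n → Y → ℤˣ, ⨆ t, (B t + L * ∑ i, ∑ l, ((ε i l : ℤ) : ℝ) * a t i l) := by
  -- The offset `B` stays general: it holds the first sample point while the others are contracted,
  -- then the contracted others while the first is treated.
  induction n with
  | zero =>
    intro B φ a D hB hφ ha hlip
    simp
  | succ n ih =>
    intro B φ a D hB hφ ha hlip
    rw [expect_fin_succ, expect_fin_succ]
    have hM : ∀ (ε : Fin n → Y → ℤˣ) t, |L * ∑ i, ∑ l, ((ε i l : ℤ) : ℝ) * a t i.succ l|
        ≤ L * (n * (Fintype.card Y * M)) := fun ε t => by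
      rw [abs_mul, abs_of_nonneg hL]
      refine mul_le_mul_of_nonneg_left ((Finset.abs_sum_le_sum_abs _ _).trans ?_) hL
      refine (Finset.sum_le_sum fun i _ => abs_sum_sign_mul_le (ε i) (ha t i.succ)).trans ?_
      simp
    calc 𝔼 s : ℤˣ, 𝔼 σ : Fin n → ℤˣ, ⨆ t, (B t + ∑ i : Fin (n + 1),
            (((Fin.cons s σ : Fin (n + 1) → ℤˣ) i : ℤ) : ℝ) * φ i t)
        = 𝔼 s : ℤˣ, 𝔼 σ : Fin n → ℤˣ, ⨆ t, ((B t + ((s : ℤ) : ℝ) * φ 0 t)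
            + ∑ i, ((σ i : ℤ) : ℝ) * φ i.succ t) := by
          simp only [Fin.sum_univ_succ, Fin.cons_zero, Fin.cons_succ, add_assoc]
      _ ≤ 𝔼 s : ℤˣ, 𝔼 ε : Fin n → Y → ℤˣ, ⨆ t, ((B t + ((s : ℤ) : ℝ) * φ 0 t)
            + L * ∑ i, ∑ l, ((ε i l : ℤ) : ℝ) * a t i.succ l) := by
          refine Finset.expect_le_expect fun s _ => ih (D := D + C) (fun t => ?_)
            (fun i t => hφ i.succ t) (fun t i l => ha t i.succ l) (fun i t t' => hlip i.succ t t')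
          refine (abs_add_le _ _).trans (add_le_add (hB t) ?_)
          rw [abs_mul, abs_units_int_cast, one_mul]
          exact hφ 0 t
      _ = 𝔼 ε : Fin n → Y → ℤˣ, 𝔼 s : ℤˣ, ⨆ t, ((B t
            + L * ∑ i, ∑ l, ((ε i l : ℤ) : ℝ) * a t i.succ l) + ((s : ℤ) : ℝ) * φ 0 t) := by
          rw [Finset.expect_comm]
          simp only [add_right_comm]
      _ ≤ 𝔼 ε : Fin n → Y → ℤˣ, 𝔼 e : Y → ℤˣ, ⨆ t, ((B t
            + L * ∑ i, ∑ l, ((ε i l : ℤ) : ℝ) * a t i.succ l)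
            + L * ∑ l, ((e l : ℤ) : ℝ) * a t 0 l) := by
          refine Finset.expect_le_expect fun ε _ => ?_
          refine expect_iSup_sign_mul_le
            (M := max (D + L * (n * (Fintype.card Y * M))) M) hL (fun t => ?_)
            (fun t l => (ha t 0 l).trans (by simp))
            (hlip 0)
          exact ((abs_add_le _ _).trans (add_le_add (hB t) (hM ε t))).trans (le_max_left _ _)
      _ = _ := by
          rw [Finset.expect_comm]
          simp only [Fin.sum_univ_succ, Fin.cons_zero, Fin.cons_succ, mul_add, add_assoc]
          simp only [add_comm]

/-- Vector contraction, with the coordinates separated. -/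
theorem expect_iSup_sign_sum_le_sum {L C M : ℝ} (hL : 0 ≤ L) {n : ℕ} {φ : Fin n → ι → ℝ}
    {a : ι → Fin n → Y → ℝ} (hφ : ∀ i t, |φ i t| ≤ C) (ha : ∀ t i l, |a t i l| ≤ M)
    (hlip : ∀ i t t', |φ i t - φ i t'| ≤ L * ‖a t i - a t' i‖) :
    𝔼 σ : Fin n → ℤˣ, ⨆ t, ∑ i, ((σ i : ℤ) : ℝ) * φ i t
      ≤ L * ∑ l, 𝔼 σ : Fin n → ℤˣ, ⨆ t, ∑ i, ((σ i : ℤ) : ℝ) * a t i l := by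
  have h := expect_iSup_sign_sum_le hL (B := fun _ => 0) (D := 0) (fun t => by simp) hφ ha hlip
  simp only [zero_add] at h
  refine h.trans ?_
  -- A supremum of a sum over labels is at most the sum of suprema, and label `l` sees only column
  -- `l` of the sign matrix.
  rw [← Finset.sum_congr rfl fun l _ => expect_sign_column (I := Fin n) l
    fun σ => ⨆ t, ∑ i, ((σ i : ℤ) : ℝ) * a t i l, ← Finset.expect_sum_comm, Finset.mul_expect]
  refine Finset.expect_le_expect fun ε _ => ciSup_le fun t => mul_le_mul_of_nonneg_left ?_ hL
  rw [Finset.sum_comm]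
  exact Finset.sum_le_sum fun l _ => le_ciSup (f := fun t => ∑ i, ((ε i l : ℤ) : ℝ) * a t i l)
    (bddAbove_range_of_abs_le fun t => abs_sum_sign_mul_le (fun i => ε i l) fun i => ha t i l) t

end Contraction

/-! ### McDiarmid's inequality. -/

section BoundedDifferences

open ProbabilityTheory

theorem integrable_of_abs_le {Ω : Type*} [MeasurableSpace Ω] {μ : Measure Ω} [IsFiniteMeasure μ]
    {f : Ω → ℝ} {M : ℝ} (hf : Measurable f) (h : ∀ x, |f x| ≤ M) : Integrable f μ :=
  Integrable.of_bound hf.aestronglyMeasurable M (ae_of_all _ h)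

theorem integrable_exp_mul_of_abs_le {Ω : Type*} [MeasurableSpace Ω] {μ : Measure Ω}
    [IsFiniteMeasure μ] {f : Ω → ℝ} {M : ℝ} (hf : Measurable f) (h : ∀ x, |f x| ≤ M) (t : ℝ) :
    Integrable (fun x => Real.exp (t * f x)) μ :=
  integrable_exp_mul_of_mem_Icc hf.aemeasurable (ae_of_all _ fun x => abs_le.1 (h x))

variable {X : Type*} [MeasurableSpace X] (P : Measure X) [IsProbabilityMeasure P]

theorem measurePreserving_finCons (n : ℕ) :
    MeasurePreserving (fun p : X × (Fin n → X) => (Fin.cons p.1 p.2 : Fin (n + 1) → X))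
      (P.prod (Measure.pi fun _ => P)) (Measure.pi fun _ => P) := by
  convert (measurePreserving_piFinSuccAbove (fun _ : Fin (n + 1) => P) 0).symm using 1
  funext p
  simp [MeasurableEquiv.piFinSuccAbove]
  rfl

/-- McDiarmid's inequality, as a bound on the moment generating function: a function of `n`
independent variables that changes by at most `c` when one of them is changed is sub-Gaussian. -/
theorem hasSubgaussianMGF_of_boundedDifferences {c : ℝ} {n : ℕ} :
    ∀ {f : (Fin n → X) → ℝ} {M : ℝ}, Measurable f → (∀ x, |f x| ≤ M) →
    (∀ x i y, f (Function.update x i y) - f x ≤ c) →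
    HasSubgaussianMGF (fun x => f x - ∫ y, f y ∂(Measure.pi fun _ : Fin n => P))
      (n * (‖c‖₊ / 2) ^ 2) (Measure.pi fun _ => P) := by
  induction n with
  | zero =>
    intro f M hf hM hc
    have h : (fun x => f x - ∫ y, f y ∂(Measure.pi fun _ : Fin 0 => P)) = fun _ => 0 := by
      funext x
      rw [show f = fun _ => f x from funext fun y => congrArg f (Subsingleton.elim y x)]
      simp
    rw [h]
    simp
  | succ n ih =>
    intro f M hf hM hc
    set μ : Measure (Fin n → X) := Measure.pi fun _ => P with hμ
    have hmp := measurePreserving_finCons P n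
    have hcons : ∀ F : (Fin (n + 1) → X) → ℝ, Measurable F →
        Integrable F (Measure.pi fun _ => P) →
        ∫ x, F x ∂(Measure.pi fun _ => P) = ∫ x, ∫ r, F (Fin.cons x r) ∂μ ∂P := by
      intro F hF hFi
      rw [← hmp.map_eq, integral_map hmp.measurable.aemeasurable hF.aestronglyMeasurable,
        integral_prod (fun p => F (Fin.cons p.1 p.2)) (hmp.integrable_comp_of_integrable hFi)]
    have hfcons : Measurable fun p : X × (Fin n → X) => f (Fin.cons p.1 p.2) :=
      hf.comp hmp.measurable
    have hslice : ∀ x, Measurable fun r : Fin n → X => f (Fin.cons x r) := fun x =>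
      hfcons.comp measurable_prodMk_left
    -- `g` is the conditional mean given the first variable. `g - E` is handled by Hoeffding's
    -- lemma, as `g` oscillates by at most `c`, and `f - g` by induction on each slice.
    set g : X → ℝ := fun x => ∫ r, f (Fin.cons x r) ∂μ with hg
    have hgm : Measurable g := (hfcons.stronglyMeasurable.integral_prod_right).measurable
    have hgM : ∀ x, |g x| ≤ M := fun x => by
      have := norm_integral_le_of_norm_le_const (μ := μ)
        (f := fun r => f (Fin.cons x r)) (C := M) (ae_of_all _ fun r => hM _)
      simpa using this
    set E := ∫ x, f x ∂(Measure.pi fun _ : Fin (n + 1) => P) with hE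
    have hEg : E = ∫ x, g x ∂P := hcons f hf (integrable_of_abs_le hf hM)
    have hgosc : ∀ x y, g x - g y ≤ c := fun x y => by
      rw [hg, ← integral_sub (integrable_of_abs_le (hslice x) fun r => hM _)
        (integrable_of_abs_le (hslice y) fun r => hM _)]
      calc ∫ r, (f (Fin.cons x r) - f (Fin.cons y r)) ∂μ ≤ ∫ _r, c ∂μ := by
            refine integral_mono ((integrable_of_abs_le (hslice x) fun r => hM _).sub
              (integrable_of_abs_le (hslice y) fun r => hM _)) (integrable_const _) fun r => ?_
            have := hc (Fin.cons y r) 0 x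
            rwa [Fin.update_cons_zero] at this
        _ = c := by simp
    obtain ⟨x0⟩ : Nonempty X := nonempty_of_isProbabilityMeasure P
    have hgbdd : BddBelow (Set.range g) :=
      ⟨-M, by rintro _ ⟨x, rfl⟩; exact (abs_le.1 (hgM x)).1⟩
    have hghoeff : HasSubgaussianMGF (fun x => g x - E) ((‖c‖₊ / 2) ^ 2) P := by
      have : Nonempty X := ⟨x0⟩
      have := hasSubgaussianMGF_of_mem_Icc (μ := P) (a := ⨅ x, g x) (b := (⨅ x, g x) + c)
        hgm.aemeasurable (ae_of_all _ fun x => ⟨ciInf_le hgbdd x, by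
          rw [← sub_le_iff_le_add]
          exact le_ciInf fun y => by linarith [hgosc x y]⟩)
      rwa [add_sub_cancel_left, ← hEg] at this
    have hEM : ∀ x, |f x - E| ≤ M + |E| := fun x =>
      (abs_sub _ _).trans (add_le_add (hM x) le_rfl)
    refine ⟨integrable_exp_mul_of_abs_le (hf.sub_const _) hEM, fun t => ?_⟩
    have hmain : mgf (fun x => f x - E) (Measure.pi fun _ => P) t
        = ∫ x, Real.exp (t * (g x - E)) * mgf (fun r => f (Fin.cons x r) - g x) μ t ∂P := by
      rw [mgf, hcons _ (by fun_prop) (integrable_exp_mul_of_abs_le (hf.sub_const _) hEM t)]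
      refine integral_congr_ae (ae_of_all _ fun x => ?_)
      simp only [mgf]
      rw [← integral_const_mul]
      refine integral_congr_ae (ae_of_all _ fun r => ?_)
      simp only
      rw [← Real.exp_add]
      ring_nf
    have hinner : ∀ x, mgf (fun r => f (Fin.cons x r) - g x) μ t
        ≤ Real.exp (((n * (‖c‖₊ / 2) ^ 2 : NNReal) : ℝ) * t ^ 2 / 2) := fun x =>
      (ih (hslice x) (fun r => hM _) fun r i y => by
        have := hc (Fin.cons x r) i.succ y
        rwa [← Fin.cons_update] at this).mgf_le t
    rw [hmain]
    calc ∫ x, Real.exp (t * (g x - E)) * mgf (fun r => f (Fin.cons x r) - g x) μ t ∂P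
        ≤ ∫ x, Real.exp (t * (g x - E))
            * Real.exp (((n * (‖c‖₊ / 2) ^ 2 : NNReal) : ℝ) * t ^ 2 / 2) ∂P := by
          refine integral_mono_of_nonneg (ae_of_all _ fun x =>
            mul_nonneg (Real.exp_pos _).le mgf_nonneg)
            ((hghoeff.integrable_exp_mul t).mul_const _) (ae_of_all _ fun x =>
            mul_le_mul_of_nonneg_left (hinner x) (Real.exp_pos _).le)
      _ = mgf (fun x => g x - E) P t
            * Real.exp (((n * (‖c‖₊ / 2) ^ 2 : NNReal) : ℝ) * t ^ 2 / 2) := by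
          rw [integral_mul_const, mgf]
      _ ≤ Real.exp ((((‖c‖₊ / 2) ^ 2 : NNReal) : ℝ) * t ^ 2 / 2)
            * Real.exp (((n * (‖c‖₊ / 2) ^ 2 : NNReal) : ℝ) * t ^ 2 / 2) :=
          mul_le_mul_of_nonneg_right (hghoeff.mgf_le t) (Real.exp_pos _).le
      _ = _ := by
          rw [← Real.exp_add]
          push_cast
          ring_nf

end BoundedDifferences

/-! ### Symmetrization and concentration of the largest deviation. -/

section Symmetrization

open Finset
open scoped BigOperators

variable {X ι : Type*} [MeasurableSpace X] (P : Measure X)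
  {f : ι → X → ℝ} {C : ℝ} {n : ℕ}

theorem abs_sum_le_mul {n : ℕ} {a : Fin n → ℝ} (h : ∀ i, |a i| ≤ C) : |∑ i, a i| ≤ n * C :=
  (Finset.abs_sum_le_sum_abs _ _).trans
    ((Finset.sum_le_sum fun i _ => h i).trans (by simp))

theorem abs_ciSup_le {ι : Type*} [Nonempty ι] {a : ι → ℝ} (h : ∀ t, |a t| ≤ C) :
    |⨆ t, a t| ≤ C := by
  obtain ⟨t⟩ := ‹Nonempty ι›
  have : Nonempty ι := ⟨t⟩
  exact abs_le.2 ⟨(abs_le.1 (h t)).1.trans (le_ciSup (bddAbove_range_of_abs_le h) t),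
    ciSup_le fun t => (abs_le.1 (h t)).2⟩

/-- The largest signed sum over a class of functions. -/
noncomputable def signedSup (f : ι → X → ℝ) (σ : Fin n → ℤˣ) (S : Fin n → X) : ℝ :=
  ⨆ t, ∑ i, ((σ i : ℤ) : ℝ) * f t (S i)

/-- The largest one-sided deviation, over a class of functions, of a sum over the sample from its
expectation. -/
noncomputable def deviationSup (f : ι → X → ℝ) (S : Fin n → X) : ℝ :=
  ⨆ t, ∑ i, (∫ x, f t x ∂P - f t (S i))

theorem abs_sign_mul_le {a : ℝ} (s : ℤˣ) (h : |a| ≤ C) : |((s : ℤ) : ℝ) * a| ≤ C := by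
  rwa [abs_mul, abs_units_int_cast, one_mul]

theorem measurable_signedSup [Countable ι] (hf : ∀ t, Measurable (f t)) (σ : Fin n → ℤˣ) :
    Measurable (signedSup f σ) := by
  unfold signedSup
  exact Measurable.iSup fun t => by fun_prop

theorem measurable_deviationSup [Countable ι] (hf : ∀ t, Measurable (f t)) :
    Measurable (deviationSup P f (n := n)) := by
  unfold deviationSup
  exact Measurable.iSup fun t => by fun_prop

variable [IsProbabilityMeasure P]

theorem abs_integral_le (hC : ∀ t x, |f t x| ≤ C) (t : ι) : |∫ x, f t x ∂P| ≤ C := by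
  simpa using norm_integral_le_of_norm_le_const (μ := P) (f := f t) (C := C)
    (ae_of_all _ fun x => hC t x)

theorem abs_sum_deviation_le (hC : ∀ t x, |f t x| ≤ C) (S : Fin n → X) (t : ι) :
    |∑ i, (∫ x, f t x ∂P - f t (S i))| ≤ n * (C + C) :=
  abs_sum_le_mul fun _ => (abs_sub _ _).trans (add_le_add (abs_integral_le P hC t) (hC t _))

theorem integrable_signedSup [Countable ι] [Nonempty ι] (hf : ∀ t, Measurable (f t)) (hC : ∀ t x, |f t x| ≤ C)
    (σ : Fin n → ℤˣ) : Integrable (signedSup f σ) (Measure.pi fun _ => P) :=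
  integrable_of_abs_le (measurable_signedSup hf σ) fun S =>
    abs_ciSup_le fun t => abs_sum_le_mul fun i => abs_sign_mul_le (σ i) (hC t (S i))

theorem integrable_deviationSup [Countable ι] [Nonempty ι] (hf : ∀ t, Measurable (f t)) (hC : ∀ t x, |f t x| ≤ C) :
    Integrable (deviationSup P f) (Measure.pi fun _ : Fin n => P) :=
  integrable_of_abs_le (measurable_deviationSup P hf) fun S =>
    abs_ciSup_le fun t => abs_sum_deviation_le P hC S t

/-- Symmetrization by a ghost sample. -/
theorem integral_deviationSup_le [Countable ι] [Nonempty ι] (hf : ∀ t, Measurable (f t)) (hC : ∀ t x, |f t x| ≤ C) :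
    ∫ S, deviationSup P f S ∂(Measure.pi fun _ : Fin n => P)
      ≤ 2 * 𝔼 σ : Fin n → ℤˣ, ∫ S, signedSup f σ S ∂(Measure.pi fun _ => P) := by
  set μ : Measure (Fin n → X) := Measure.pi fun _ => P with hμ
  set ν : Measure (Fin n → X × X) := Measure.pi fun _ => P.prod P with hν
  set Δ : (Fin n → X × X) → ℝ := fun z => ⨆ t, ∑ i, (f t (z i).2 - f t (z i).1) with hΔ
  have hΔC : ∀ (z : Fin n → X × X) t, |∑ i, (f t (z i).2 - f t (z i).1)| ≤ n * (C + C) := fun z t =>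
    abs_sum_le_mul fun i => (abs_sub _ _).trans (add_le_add (hC t _) (hC t _))
  have hΔm : Measurable Δ := Measurable.iSup fun t => by fun_prop
  have hΔi : Integrable Δ ν := integrable_of_abs_le hΔm fun z => abs_ciSup_le (hΔC z)
  have hzip : MeasurePreserving (fun p : (Fin n → X) × (Fin n → X) => fun i => (p.1 i, p.2 i))
      (μ.prod μ) ν :=
    (measurePreserving_arrowProdEquivProdArrow X X (Fin n) (fun _ => P) (fun _ => P)).symm
  -- The expectation of `f t` is a mean over a ghost sample, and a supremum of means is at most the
  -- mean of the supremum.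
  have hghost : ∫ S, deviationSup P f S ∂μ ≤ ∫ z, Δ z ∂ν := by
    rw [← hzip.map_eq, integral_map hzip.measurable.aemeasurable hΔm.aestronglyMeasurable,
      integral_prod (fun p : (Fin n → X) × (Fin n → X) => Δ fun i => (p.1 i, p.2 i)) (hzip.integrable_comp_of_integrable hΔi)]
    refine integral_mono (integrable_deviationSup P hf hC)
      (hzip.integrable_comp_of_integrable hΔi).integral_prod_left fun S => ?_
    refine ciSup_le fun t => ?_
    have hterm : ∀ i, Integrable (fun S' : Fin n → X => f t (S' i) - f t (S i)) μ := fun i =>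
      integrable_of_abs_le (M := C + C) (by fun_prop) fun S' =>
        (abs_sub _ _).trans (add_le_add (hC t _) (hC t _))
    calc ∑ i, (∫ x, f t x ∂P - f t (S i))
        = ∑ i, ∫ S', (f t (S' i) - f t (S i)) ∂μ := by
          refine Finset.sum_congr rfl fun i _ => ?_
          rw [integral_sub (integrable_of_abs_le (f := fun S' : Fin n → X => f t (S' i))
            (by fun_prop) fun S' => hC t (S' i)) (integrable_const _), integral_comp_eval (μ := fun _ => P)
            (hf t).aestronglyMeasurable]
          simp
      _ = ∫ S', ∑ i, (f t (S' i) - f t (S i)) ∂μ :=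
          (integral_finsetSum _ fun i _ => hterm i).symm
      _ ≤ _ := by
          refine integral_mono (integrable_finsetSum _ fun i _ => hterm i)
            (integrable_of_abs_le (M := n * (C + C)) (by fun_prop) fun S' =>
              abs_ciSup_le (hΔC fun i => (S i, S' i))) fun S' => ?_
          exact le_ciSup (bddAbove_range_of_abs_le (hΔC fun i => (S i, S' i))) t
  have hfst : MeasurePreserving (fun z : Fin n → X × X => fun i => (z i).1) ν μ :=
    measurePreserving_pi _ _ fun _ => measurePreserving_fst
  have hsnd : MeasurePreserving (fun z : Fin n → X × X => fun i => (z i).2) ν μ :=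
    measurePreserving_pi _ _ fun _ => measurePreserving_snd
  have hsign : ∀ σ : Fin n → ℤˣ,
      ∫ z, Δ z ∂ν ≤ ∫ S, signedSup f σ S ∂μ + ∫ S, signedSup f (-σ) S ∂μ := by
    intro σ
    set e : ℤˣ → X × X → X × X := fun s => if s = 1 then id else Prod.swap with he
    -- Exchanging a sample point with its ghost where `σ i = -1` preserves the law and multiplies
    -- the `i`-th difference by `σ i`.
    have hflip : MeasurePreserving (fun z : Fin n → X × X => fun i => e (σ i) (z i)) ν ν := by
      refine measurePreserving_pi _ _ fun i => ?_
      simp only [he]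
      split_ifs
      · exact MeasurePreserving.id _
      · exact Measure.measurePreserving_swap
    have hterm : ∀ (s : ℤˣ) t (y : X × X), f t (e s y).2 - f t (e s y).1
        = ((s : ℤ) : ℝ) * f t y.2 + (((-s : ℤˣ) : ℤ) : ℝ) * f t y.1 := by
      intro s t y
      rcases Int.units_eq_one_or s with rfl | rfl
      · simp [he]; ring
      · simp [he, show (-1 : ℤˣ) ≠ 1 by decide]; ring
    calc ∫ z, Δ z ∂ν = ∫ z, Δ (fun i => e (σ i) (z i)) ∂ν := by
          conv_lhs => rw [← hflip.map_eq]
          exact integral_map hflip.measurable.aemeasurable hΔm.aestronglyMeasurable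
      _ ≤ ∫ z, (signedSup f σ (fun i => (z i).2) + signedSup f (-σ) (fun i => (z i).1)) ∂ν := by
          refine integral_mono (hflip.integrable_comp_of_integrable hΔi)
            ((hsnd.integrable_comp_of_integrable (integrable_signedSup P hf hC σ)).add
            (hfst.integrable_comp_of_integrable (integrable_signedSup P hf hC (-σ)))) fun z => ?_
          refine ciSup_le fun t => ?_
          simp only [hterm, Finset.sum_add_distrib]
          have hb : ∀ (τ : Fin n → ℤˣ) (S : Fin n → X),
              ∑ i, ((τ i : ℤ) : ℝ) * f t (S i) ≤ signedSup f τ S := fun τ S =>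
            le_ciSup (f := fun t => ∑ i, ((τ i : ℤ) : ℝ) * f t (S i))
              (bddAbove_range_of_abs_le fun t =>
                abs_sum_le_mul fun i => abs_sign_mul_le (τ i) (hC t (S i))) t
          exact add_le_add (hb σ _) (hb (-σ) _)
      _ = ∫ z, signedSup f σ (fun i => (z i).2) ∂ν
            + ∫ z, signedSup f (-σ) (fun i => (z i).1) ∂ν :=
          integral_add (hsnd.integrable_comp_of_integrable (integrable_signedSup P hf hC σ))
            (hfst.integrable_comp_of_integrable (integrable_signedSup P hf hC (-σ)))
      _ = _ := by
          congr 1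
          · rw [← hsnd.map_eq, integral_map hsnd.measurable.aemeasurable
              (measurable_signedSup hf σ).aestronglyMeasurable]
          · rw [← hfst.map_eq, integral_map hfst.measurable.aemeasurable
              (measurable_signedSup hf (-σ)).aestronglyMeasurable]
  have hneg : 𝔼 σ : Fin n → ℤˣ, ∫ S, signedSup f (-σ) S ∂μ
      = 𝔼 σ : Fin n → ℤˣ, ∫ S, signedSup f σ S ∂μ :=
    Finset.expect_equiv (Equiv.neg _) (by simp) (by simp)
  have := Finset.le_expect (s := (Finset.univ : Finset (Fin n → ℤˣ))) Finset.univ_nonempty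
    fun σ _ => hghost.trans (hsign σ)
  rw [Finset.expect_add_distrib, hneg] at this
  linarith

/-- Only one summand changes, by `f t (S i) - f t y`; the range `[0, C]` makes this at most `C`
instead of `2 * C`. -/
theorem deviationSup_update_sub_le [Nonempty ι] (hC : ∀ t x, 0 ≤ f t x ∧ f t x ≤ C) (S : Fin n → X)
    (i : Fin n) (y : X) :
    deviationSup P f (Function.update S i y) - deviationSup P f S ≤ C := by
  have habs : ∀ t x, |f t x| ≤ C := fun t x => by
    rw [abs_of_nonneg (hC t x).1]; exact (hC t x).2
  rw [sub_le_iff_le_add']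
  refine ciSup_le fun t => ?_
  have h1 : ∑ j, (∫ x, f t x ∂P - f t (S j)) ≤ deviationSup P f S :=
    le_ciSup (f := fun t => ∑ j, (∫ x, f t x ∂P - f t (S j)))
      (bddAbove_range_of_abs_le (abs_sum_deviation_le P habs S)) t
  have h2 : ∑ j, (∫ x, f t x ∂P - f t (Function.update S i y j))
      = ∑ j, (∫ x, f t x ∂P - f t (S j)) + (f t (S i) - f t y) := by
    rw [← sub_eq_iff_eq_add', ← Finset.sum_sub_distrib, Finset.sum_eq_single i]
    · simp
    · intro j _ hj
      simp [Function.update_of_ne hj]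
    · simp
  rw [h2]
  linarith [(hC t (S i)).2, (hC t y).1]

/-- The largest deviation rarely exceeds its expectation by much. -/
theorem measureReal_deviationSup_ge_le [Countable ι] [Nonempty ι] (hf : ∀ t, Measurable (f t))
    (hC : ∀ t x, 0 ≤ f t x ∧ f t x ≤ C) {r : ℝ} (hr : 0 ≤ r) :
    (Measure.pi fun _ : Fin n => P).real
      {S | r ≤ deviationSup P f S - ∫ S, deviationSup P f S ∂(Measure.pi fun _ : Fin n => P)}
      ≤ Real.exp (-(2 * r ^ 2 / (n * C ^ 2))) := by
  have habs : ∀ t x, |f t x| ≤ C := fun t x => by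
    rw [abs_of_nonneg (hC t x).1]; exact (hC t x).2
  refine ((hasSubgaussianMGF_of_boundedDifferences P (c := C) (measurable_deviationSup P hf)
    (fun S => abs_ciSup_le fun t => abs_sum_deviation_le P habs S t)
    (deviationSup_update_sub_le P hC)).measure_ge_le hr).trans (le_of_eq ?_)
  congr 1
  push_cast
  rw [Real.norm_eq_abs, div_pow, sq_abs]
  ring

end Symmetrization

/-! ### Extended-real Rademacher complexity and contraction in expectation. -/

section Rademacher

open Finset
open scoped BigOperators

theorem ereal_coe_sum {ι : Type*} (s : Finset ι) (r : ι → ℝ) :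
    ((∑ i ∈ s, r i : ℝ) : EReal) = ∑ i ∈ s, (r i : EReal) := by
  classical
  induction s using Finset.induction_on with
  | empty => simp
  | insert i s hi ih => rw [Finset.sum_insert hi, Finset.sum_insert hi, EReal.coe_add, ih]

theorem ereal_sum_eq_top {ι : Type*} {s : Finset ι} {r : ι → EReal} (hbot : ∀ i ∈ s, r i ≠ ⊥)
    {i : ι} (hi : i ∈ s) (htop : r i = ⊤) : ∑ i ∈ s, r i = ⊤ := by
  classical
  rw [← Finset.add_sum_erase s r hi, htop]
  refine EReal.top_add_of_ne_bot ?_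
  refine Finset.sum_induction r (fun x => x ≠ ⊥) (fun a b ha hb => ?_) EReal.zero_ne_bot
    fun j hj => hbot j (Finset.mem_of_mem_erase hj)
  rw [Ne, EReal.add_eq_bot_iff]
  tauto

variable {X ι : Type*} {N : ℕ}

theorem empiricalRademacher_mono (S : Fin N → X) {G G' : Set (X → ℝ)} (h : G ⊆ G') :
    empiricalRademacher S G ≤ empiricalRademacher S G' := by
  unfold empiricalRademacher
  refine mul_le_mul_of_nonneg_left (Finset.sum_le_sum fun σ _ => biSup_mono h) ?_
  exact EReal.coe_nonneg.2 (by positivity)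

theorem rademacher_mono [MeasurableSpace X] (P : Measure X) (N : ℕ) {G G' : Set (X → ℝ)}
    (h : G ⊆ G') : rademacher P N G ≤ rademacher P N G' :=
  lintegral_mono fun S => EReal.toENNReal_le_toENNReal (empiricalRademacher_mono S h)

theorem measurable_empiricalRademacher [MeasurableSpace X] [Countable ι] {b : ι → X → ℝ}
    (hb : ∀ t, Measurable (b t)) :
    Measurable fun S : Fin N → X => empiricalRademacher S (Set.range b) := by
  simp only [empiricalRademacher, iSup_range]
  refine Measurable.const_mul (Finset.measurable_sum _ fun σ _ => Measurable.iSup fun t => ?_) _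
  exact measurable_coe_real_ereal.comp (by fun_prop)

/-- A class with finite empirical Rademacher complexity is bounded on the sample, and its
complexity is the average of real suprema. -/
theorem bounded_and_expect_signedSup_le [Nonempty ι] (hN : 0 < N) (S : Fin N → X)
    (b : ι → X → ℝ) (h : empiricalRademacher S (Set.range b) ≠ ⊤) :
    (∃ M, ∀ t i, |b t (S i)| ≤ M) ∧
      ((1 / (N : ℝ) * 𝔼 σ, signedSup b σ S : ℝ) : EReal) ≤ empiricalRademacher S (Set.range b) := by
  have hNpos : (0 : ℝ) < N := Nat.cast_pos.2 hN
  simp only [empiricalRademacher, iSup_range] at h ⊢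
  set s : (Fin N → ℤˣ) → EReal :=
    fun σ => ⨆ t, (((1 / (N : ℝ)) * ∑ i, ((σ i : ℤ) : ℝ) * b t (S i) : ℝ) : EReal) with hs
  have hle : ∀ σ t, (((1 / (N : ℝ)) * ∑ i, ((σ i : ℤ) : ℝ) * b t (S i) : ℝ) : EReal) ≤ s σ :=
    fun σ t => le_iSup (fun t => (((1 / (N : ℝ)) * ∑ i, ((σ i : ℤ) : ℝ) * b t (S i) : ℝ) : EReal)) t
  have hbot : ∀ σ, s σ ≠ ⊥ := fun σ =>
    ne_bot_of_le_ne_bot (EReal.coe_ne_bot _) (hle σ (Classical.arbitrary ι))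
  have htop : ∀ σ, s σ ≠ ⊤ := fun σ hσ => h (by
    rw [ereal_sum_eq_top (fun σ _ => hbot σ) (Finset.mem_univ σ) hσ]
    exact EReal.coe_mul_top_of_pos (by positivity))
  have hcoe : ∀ σ, ((s σ).toReal : EReal) = s σ := fun σ => EReal.coe_toReal (htop σ) (hbot σ)
  have hreal : ∀ σ t, ∑ i, ((σ i : ℤ) : ℝ) * b t (S i) ≤ N * (s σ).toReal := fun σ t => by
    have := hle σ t
    rw [← hcoe, EReal.coe_le_coe_iff, one_div, inv_mul_le_iff₀ hNpos] at this
    exact this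
  constructor
  · refine ⟨N * ∑ σ, |(s σ).toReal|, fun t i => ?_⟩
    -- These signs turn the signed sum into a sum of absolute values. They depend on `t`, which is
    -- why the bound sums over all sign vectors.
    set σ : Fin N → ℤˣ := fun i => if 0 ≤ b t (S i) then 1 else -1 with hσ
    have habs : ∀ i, ((σ i : ℤ) : ℝ) * b t (S i) = |b t (S i)| := fun i => by
      simp only [hσ]
      split_ifs with h0
      · simp [abs_of_nonneg h0]
      · simp [abs_of_neg (not_le.1 h0)]
    calc |b t (S i)| ≤ ∑ i, |b t (S i)| :=
          Finset.single_le_sum (f := fun i => |b t (S i)|) (fun i _ => abs_nonneg _)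
            (Finset.mem_univ i)
      _ = ∑ i, ((σ i : ℤ) : ℝ) * b t (S i) := by simp only [habs]
      _ ≤ N * (s σ).toReal := hreal σ t
      _ ≤ _ := mul_le_mul_of_nonneg_left ((le_abs_self _).trans
          (Finset.single_le_sum (f := fun σ => |(s σ).toReal|) (fun σ _ => abs_nonneg _)
            (Finset.mem_univ σ))) hNpos.le
  · have hsum : ∑ σ, s σ = ((∑ σ, (s σ).toReal : ℝ) : EReal) := by
      rw [ereal_coe_sum]
      exact Finset.sum_congr rfl fun σ _ => (hcoe σ).symm
    rw [hsum, ← EReal.coe_mul, EReal.coe_le_coe_iff, one_div, inv_mul_le_iff₀ hNpos]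
    calc 𝔼 σ, signedSup b σ S ≤ 𝔼 σ, N * (s σ).toReal :=
          Finset.expect_le_expect fun σ _ => ciSup_le fun t => hreal σ t
      _ = _ := by
          rw [← Finset.mul_expect, Fintype.expect_eq_sum_div_card]
          simp [div_eq_inv_mul]

/-- Contraction for the empirical Rademacher complexity: a class of functions that are bounded and
depend on a vector-valued class in a Lipschitz way is controlled by the coordinates of the latter. -/
theorem ofReal_expect_signedSup_le [Nonempty ι] {Y : Type*} [Fintype Y] [Nonempty Y] (hN : 0 < N)
    {L C : ℝ} (hL : 0 < L) {f : ι → X → ℝ} {a : ι → X → Y → ℝ} (hC : ∀ t x, |f t x| ≤ C)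
    (hlip : ∀ t t' x, |f t x - f t' x| ≤ L * ‖a t x - a t' x‖) (S : Fin N → X) :
    ENNReal.ofReal (𝔼 σ, signedSup f σ S)
      ≤ ENNReal.ofReal (L * N) *
        ∑ l, (empiricalRademacher S (Set.range fun t x => a t x l)).toENNReal := by
  classical
  have hNpos : (0 : ℝ) < N := Nat.cast_pos.2 hN
  -- An infinite coordinate makes the right side `⊤`; otherwise the logits are bounded on the
  -- sample, as the real-valued contraction requires.
  by_cases htop : ∃ l, empiricalRademacher S (Set.range fun t x => a t x l) = ⊤
  · obtain ⟨l, hl⟩ := htop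
    have : ∑ l, (empiricalRademacher S (Set.range fun t x => a t x l)).toENNReal = ⊤ :=
      ENNReal.sum_eq_top.2 ⟨l, Finset.mem_univ l, by rw [hl]; rfl⟩
    rw [this, ENNReal.mul_top (by simpa using mul_pos hL hNpos)]
    exact le_top
  push Not at htop
  have hrad := fun l => bounded_and_expect_signedSup_le hN S (fun t x => a t x l) (htop l)
  choose M hM using fun l => (hrad l).1
  have hcontr := expect_iSup_sign_sum_le_sum (φ := fun i t => f t (S i))
    (a := fun t i => a t (S i)) (C := C) (M := ∑ l, |M l|) hL.le (fun i t => hC t (S i))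
    (fun t i l => (hM l t i).trans ((le_abs_self _).trans
      (Finset.single_le_sum (f := fun l => |M l|) (fun _ _ => abs_nonneg _) (Finset.mem_univ l))))
    fun i t t' => hlip t t' (S i)
  calc ENNReal.ofReal (𝔼 σ, signedSup f σ S)
      ≤ ENNReal.ofReal (L * N * ∑ l, 1 / (N : ℝ) * 𝔼 σ, signedSup (fun t x => a t x l) σ S) := by
        refine ENNReal.ofReal_le_ofReal (hcontr.trans (le_of_eq ?_))
        rw [← Finset.mul_sum]
        simp only [signedSup]
        field_simp
    _ ≤ ENNReal.ofReal (L * N) *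
          ∑ l, ENNReal.ofReal (1 / (N : ℝ) * 𝔼 σ, signedSup (fun t x => a t x l) σ S) := by
        rw [ENNReal.ofReal_mul (by positivity)]
        gcongr
        exact Finset.le_sum_of_subadditive ENNReal.ofReal ENNReal.ofReal_zero.le
          (fun _ _ => ENNReal.ofReal_add_le) _ _
    _ ≤ _ := by
        gcongr with l
        rw [← EReal.real_coe_toENNReal]
        exact EReal.toENNReal_le_toENNReal (hrad l).2

theorem ofReal_integral_le_lintegral {Ω : Type*} [MeasurableSpace Ω] {μ : Measure Ω} {F : Ω → ℝ}
    (hF : Integrable F μ) : ENNReal.ofReal (∫ x, F x ∂μ) ≤ ∫⁻ x, ENNReal.ofReal (F x) ∂μ := by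
  rw [integral_eq_lintegral_pos_part_sub_lintegral_neg_part hF]
  exact (ENNReal.ofReal_le_ofReal (sub_le_self _ ENNReal.toReal_nonneg)).trans
    ENNReal.ofReal_toReal_le

theorem ofReal_expect_integral_signedSup_le [MeasurableSpace X] (P : Measure X)
    [IsProbabilityMeasure P] [Countable ι] [Nonempty ι] {Y : Type*} [Fintype Y] [Nonempty Y]
    (hN : 0 < N) {L C : ℝ} (hL : 0 < L) {f : ι → X → ℝ} {a : ι → X → Y → ℝ}
    (hf : ∀ t, Measurable (f t)) (ha : ∀ t, Measurable (a t)) (hC : ∀ t x, |f t x| ≤ C)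
    (hlip : ∀ t t' x, |f t x - f t' x| ≤ L * ‖a t x - a t' x‖) :
    ENNReal.ofReal (𝔼 σ : Fin N → ℤˣ, ∫ S, signedSup f σ S ∂(Measure.pi fun _ => P))
      ≤ ENNReal.ofReal (L * N) * ∑ l, rademacher P N (Set.range fun t x => a t x l) := by
  have hint := fun σ : Fin N → ℤˣ => integrable_signedSup P hf hC σ
  have hswap : 𝔼 σ : Fin N → ℤˣ, ∫ S, signedSup f σ S ∂(Measure.pi fun _ => P)
      = ∫ S, 𝔼 σ : Fin N → ℤˣ, signedSup f σ S ∂(Measure.pi fun _ => P) := by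
    simp only [Fintype.expect_eq_sum_div_card]
    rw [integral_div, integral_finsetSum _ fun σ _ => hint σ]
  have hexp : Integrable (fun S => 𝔼 σ : Fin N → ℤˣ, signedSup f σ S)
      (Measure.pi fun _ => P) := by
    simp only [Fintype.expect_eq_sum_div_card]
    exact (integrable_finsetSum _ fun σ _ => hint σ).div_const _
  have hmeas : ∀ l, Measurable fun S : Fin N → X =>
      (empiricalRademacher S (Set.range fun t x => a t x l)).toENNReal := fun l =>
    (measurable_empiricalRademacher fun t => (measurable_pi_apply l).comp (ha t)).ereal_toENNReal
  rw [hswap]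
  refine (ofReal_integral_le_lintegral hexp).trans
    ((lintegral_mono fun S => ofReal_expect_signedSup_le hN hL hC hlip S).trans (le_of_eq ?_))
  rw [lintegral_const_mul _ (Finset.measurable_sum _ fun l _ => hmeas l),
    lintegral_finsetSum _ fun l _ => hmeas l]
  rfl

end Rademacher

/-! ### Passage to pointwise limits, and the degenerate cost. -/

section Generalization

open scoped BigOperators

/-- The excess of the expected over the empirical loss, for a member of a class in which the
countable class `u` is pointwise dense. -/
theorem integral_sub_average_le_deviationSup {X : Type*} [MeasurableSpace X] (P : Measure X)
    [IsProbabilityMeasure P] {ι : Type*} [Nonempty ι] {f : ι → X → ℝ} {C : ℝ}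
    (hf : ∀ t, Measurable (f t)) (hC : ∀ t x, |f t x| ≤ C) {F : X → ℝ} {u : ℕ → ι}
    (hu : ∀ x, Tendsto (fun n => f (u n) x) atTop (𝓝 (F x))) {N : ℕ} (S : Fin N → X) :
    ∑ i, (∫ x, F x ∂P - F (S i)) ≤ deviationSup P f S := by
  have hlim : Tendsto (fun n => ∑ i, (∫ x, f (u n) x ∂P - f (u n) (S i))) atTop
      (𝓝 (∑ i, (∫ x, F x ∂P - F (S i)))) :=
    tendsto_finsetSum _ fun i _ => Tendsto.sub
      (tendsto_integral_of_dominated_convergence (fun _ => C)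
        (fun n => (hf (u n)).aestronglyMeasurable) (integrable_const C)
        (fun n => ae_of_all _ fun x => hC (u n) x) (ae_of_all _ hu)) (hu (S i))
  refine le_of_tendsto' hlim fun n => ?_
  exact le_ciSup (f := fun t => ∑ i, (∫ x, f t x ∂P - f t (S i)))
    (bddAbove_range_of_abs_le (abs_sum_deviation_le P hC S)) (u n)

theorem loss_eq_zero_of_maxCost_eq_zero {Y K : Type*} [Fintype Y] [MetricSpace Y] [Fintype K]
    {W : K → (Y → ℝ) → ℝ} {p : K → Y → ℝ} (hW : ∀ k, 0 ≤ W k (p k))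
    (hp : ∀ k, p k ∈ stdSimplex ℝ Y) (h : maxCost Y = 0) (v : Y → ℝ) :
    loss W (softmax v) p = 0 := by
  rcases isEmpty_or_nonempty Y with hY | hY
  · simp [loss, wasserstein1]
  · exact le_antisymm (h ▸ loss_le_maxCost hW hp (softmax_mem_stdSimplex v)) (loss_nonneg hW _)

end Generalization

/-! ### The uniform deviation bound. -/

section UniformDeviation

open scoped BigOperators

theorem sum_rademacher_le {X Y : Type*} [MeasurableSpace X] [Fintype Y] (P : Measure X) (N : ℕ)
    {H₀ Ho : Set (X → Y → ℝ)} (hsub : H₀ ⊆ Ho) :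
    ∑ l, rademacher P N (Set.range fun (t : H₀) x => t.1 x l)
      ≤ Fintype.card Y * logitRademacher P N Ho := by
  have h : ∀ l, rademacher P N (Set.range fun (t : H₀) x => t.1 x l)
      ≤ logitRademacher P N Ho := fun l => by
    refine le_iSup_of_le l (rademacher_mono P N ?_)
    rintro _ ⟨t, rfl⟩
    exact ⟨t.1, hsub t.2, rfl⟩
  exact (Finset.sum_le_sum fun l _ => h l).trans (by simp)

/-- With high probability, the expected loss exceeds the empirical one by little, uniformly over
the global class. -/
theorem exists_uniform_deviation
    {X Y K : Type*} [MeasurableSpace X] [Fintype Y] [Nonempty Y] [MetricSpace Y] [Fintype K]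
    (P : Measure X) [IsProbabilityMeasure P]
    {hloc : K → X → Y → ℝ} (hloc_meas : ∀ k, Measurable (hloc k))
    (hloc_simplex : ∀ k x, hloc k x ∈ stdSimplex ℝ Y)
    {W : K → (Y → ℝ) → ℝ} (hW_meas : ∀ k, Measurable (W k))
    (hW_nonneg : ∀ k, ∀ p ∈ stdSimplex ℝ Y, 0 ≤ W k p)
    {Ho : Set (X → Y → ℝ)} (hHo_meas : ∀ h ∈ Ho, Measurable h) (hHo_sep : PointwiseSeparable Ho)
    (hHo : Ho.Nonempty) {N : ℕ} (hN : 0 < N) {δ : ℝ} (hδ : 0 < δ) (hδ1 : δ ≤ 1)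
    (hcost : 0 < maxCost Y) :
    ∃ A : Set (Fin N → X), MeasurableSet A ∧
      1 - ENNReal.ofReal δ ≤ Measure.pi (fun _ : Fin N => P) A ∧
      ∀ S ∈ A, ∀ h ∈ Ho, ∀ ρ : ℝ, 0 ≤ ρ → logitRademacher P N Ho = ENNReal.ofReal ρ →
        risk P W hloc (fun x => softmax (h x)) ≤ empiricalRisk S W hloc (fun x => softmax (h x))
          + 4 * Fintype.card Y * maxCost Y * ρ
          + maxCost Y * Real.sqrt (Real.log (1 / δ) / (2 * N)) := by
  obtain ⟨H₀, hsub, hcount, hdense⟩ := hHo_sep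
  have : Nonempty H₀ := by
    obtain ⟨h, hh⟩ := hHo
    obtain ⟨u, hu, -⟩ := hdense h hh
    exact ⟨⟨u 0, hu 0⟩⟩
  have : Countable H₀ := hcount.to_subtype
  have hNpos : (0 : ℝ) < N := Nat.cast_pos.2 hN
  set C := maxCost Y with hCdef
  set F : (X → Y → ℝ) → X → ℝ := fun h x => loss W (softmax (h x)) fun k => hloc k x with hF
  have hWx : ∀ x k, 0 ≤ W k (hloc k x) := fun x k => hW_nonneg k _ (hloc_simplex k x)
  have hFbound : ∀ h x, 0 ≤ F h x ∧ F h x ≤ C := fun h x =>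
    ⟨loss_nonneg (hWx x) _, loss_le_maxCost (hWx x) (fun k => hloc_simplex k x)
      (softmax_mem_stdSimplex _)⟩
  have hFlip : ∀ h h' x, |F h x - F h' x| ≤ 2 * C * ‖h x - h' x‖ := fun h h' x =>
    abs_loss_softmax_sub_le (hWx x) (fun k => hloc_simplex k x) _ _
  set f : H₀ → X → ℝ := fun h => F h.1 with hf
  have hfm : ∀ t, Measurable (f t) := fun t =>
    measurable_loss hW_meas (measurable_softmax.comp (hHo_meas _ (hsub t.2))) hloc_meas
      (fun x => softmax_mem_stdSimplex _) hloc_simplex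
  have hfabs : ∀ t x, |f t x| ≤ C := fun t x => by
    rw [abs_of_nonneg (hFbound t.1 x).1]; exact (hFbound t.1 x).2
  set μ : Measure (Fin N → X) := Measure.pi fun _ => P with hμ
  set E : ℝ := ∫ S, deviationSup P f S ∂μ with hE
  -- Chosen so that the McDiarmid exponent `2 * r ^ 2 / (N * C ^ 2)` is `log (1 / δ)`; the factor
  -- `N` is there because `deviationSup` is a sum, not an average.
  set r : ℝ := N * (C * Real.sqrt (Real.log (1 / δ) / (2 * N))) with hr
  have hlog : 0 ≤ Real.log (1 / δ) := Real.log_nonneg ((one_le_div hδ).2 hδ1)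
  have hr0 : 0 ≤ r := by positivity
  have hDm : Measurable fun S : Fin N → X => deviationSup P f S - E :=
    (measurable_deviationSup P hfm).sub_const E
  have hbad : MeasurableSet {S : Fin N → X | r ≤ deviationSup P f S - E} :=
    measurableSet_le measurable_const hDm
  have htail : μ {S | r ≤ deviationSup P f S - E} ≤ ENNReal.ofReal δ := by
    have h := measureReal_deviationSup_ge_le P hfm (C := C) (n := N)
      (fun t x => hFbound t.1 x) hr0
    have hexp : 2 * r ^ 2 / (N * C ^ 2) = Real.log (1 / δ) := by
      rw [hr, mul_pow, mul_pow, Real.sq_sqrt (by positivity)]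
      field_simp
    rw [hexp, one_div, Real.log_inv, neg_neg, Real.exp_log hδ] at h
    exact (ENNReal.le_ofReal_iff_toReal_le (measure_ne_top _ _) hδ.le).2 h
  refine ⟨{S | r ≤ deviationSup P f S - E}ᶜ, hbad.compl, ?_, ?_⟩
  · rw [measure_compl hbad (measure_ne_top _ _), measure_univ]
    exact tsub_le_tsub_left htail 1
  intro S hS h hh ρ hρ hrad
  have hS' : deviationSup P f S < E + r := by
    have : ¬ r ≤ deviationSup P f S - E := hS
    linarith
  -- The `4` is the `2` of symmetrization times the `2` of the Lipschitz constant `2 * C`.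
  have hErad : E ≤ N * (4 * Fintype.card Y * C * ρ) := by
    have hsum : ∑ l, rademacher P N (Set.range fun (t : H₀) x => t.1 x l)
        ≤ ENNReal.ofReal (Fintype.card Y * ρ) := by
      refine (sum_rademacher_le P N hsub).trans (le_of_eq ?_)
      rw [hrad, ENNReal.ofReal_mul (Nat.cast_nonneg _), ENNReal.ofReal_natCast]
    have h1 := (ofReal_expect_integral_signedSup_le P hN (L := 2 * C) (a := fun t : H₀ => t.1)
      (by positivity) hfm (fun t => hHo_meas _ (hsub t.2)) hfabs
      (fun t t' x => hFlip t.1 t'.1 x)).trans (mul_le_mul_right hsum _)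
    rw [← ENNReal.ofReal_mul (by positivity), ENNReal.ofReal_le_ofReal_iff (by positivity)] at h1
    have h2 := integral_deviationSup_le P hfm hfabs (n := N)
    linarith
  obtain ⟨u, hu, hlim⟩ := hdense h hh
  -- The Lipschitz bound turns convergence of logits into convergence of losses.
  have hFlim : ∀ x, Tendsto (fun n => f ⟨u n, hu n⟩ x) atTop (𝓝 (F h x)) := fun x => by
    rw [tendsto_iff_dist_tendsto_zero]
    have hz : Tendsto (fun n => 2 * C * ‖u n x - h x‖) atTop (𝓝 0) := by
      have := (tendsto_iff_norm_sub_tendsto_zero.1 (hlim x)).const_mul (2 * C)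
      rwa [mul_zero] at this
    exact squeeze_zero (fun _ => dist_nonneg) (fun n => hFlip (u n) h x) hz
  have hdev := (integral_sub_average_le_deviationSup P hfm hfabs hFlim S).trans hS'.le
  rw [Finset.sum_sub_distrib] at hdev
  have hrisk : risk P W hloc (fun x => softmax (h x)) = ∫ x, F h x ∂P := rfl
  have hemp : empiricalRisk S W hloc (fun x => softmax (h x)) = 1 / (N : ℝ) * ∑ i, F h (S i) := rfl
  rw [hrisk, hemp]
  simp only [Finset.sum_const, Finset.card_univ, Fintype.card_fin, nsmul_eq_mul] at hdev
  refine le_of_mul_le_mul_left ?_ hNpos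
  have hcancel : (N : ℝ) * (1 / (N : ℝ) * ∑ i, F h (S i)) = ∑ i, F h (S i) := by
    field_simp
  rw [mul_add, mul_add, hcancel]
  linarith

end UniformDeviation

end Distill

/-! ### From the uniform bound to empirical minimizers. -/

open Distill

theorem theorem1
    {X Y K : Type*} [MeasurableSpace X] [Fintype Y] [MetricSpace Y] [Fintype K]
    (P : MeasureTheory.Measure X) [MeasureTheory.IsProbabilityMeasure P]
    (hloc : K → X → Y → ℝ) (hloc_meas : ∀ k, Measurable (hloc k))
    (hloc_simplex : ∀ k x, hloc k x ∈ stdSimplex ℝ Y)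
    (W : K → (Y → ℝ) → ℝ) (hW_meas : ∀ k, Measurable (W k))
    (hW_nonneg : ∀ k, ∀ p ∈ stdSimplex ℝ Y, 0 ≤ W k p)
    (Ho : Set (X → Y → ℝ)) (hHo_meas : ∀ h ∈ Ho, Measurable h)
    (hHo_sep : Distill.PointwiseSeparable Ho)
    (N : ℕ) (hN : 0 < N) (δ : ℝ) (hδ : 0 < δ) :
    ∃ A : Set (Fin N → X), MeasurableSet A ∧
      1 - ENNReal.ofReal δ ≤ MeasureTheory.Measure.pi (fun _ : Fin N => P) A ∧
      ∀ S ∈ A, ∀ g : X → Y → ℝ, Distill.IsEmpiricalRiskMinimizer S W hloc Ho g →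
        (Distill.risk P W hloc g : EReal) ≤
          ((⨅ g' : Distill.globalClass Ho, Distill.empiricalRisk S W hloc g'.1 : ℝ) : EReal)
          + ((32 * (Fintype.card Y : ℝ) * Distill.maxCost Y : ℝ) : EReal)
            * ((Distill.logitRademacher P N Ho : ENNReal) : EReal)
          + ((2 * Distill.maxCost Y * (Fintype.card Y : ℝ)
              * Real.sqrt ((Fintype.card Y : ℝ) * (Real.log (1 / δ) / (2 * (N : ℝ)))) : ℝ)
              : EReal) := by

  by_cases hδ1 : 1 ≤ δ
  · exact ⟨∅, MeasurableSet.empty, by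
      rw [tsub_eq_zero_of_le (ENNReal.one_le_ofReal.2 hδ1)]; exact zero_le, fun S hS => hS.elim⟩
  push Not at hδ1
  have hWx : ∀ x k, 0 ≤ W k (hloc k x) := fun x k => hW_nonneg k _ (hloc_simplex k x)
  have hcost0 : 0 ≤ maxCost Y := maxCost_nonneg
  have hemp0 : ∀ (S : Fin N → X) (g : globalClass Ho), 0 ≤ empiricalRisk S W hloc g.1 :=
    fun S g => mul_nonneg (by positivity)
      (Finset.sum_nonneg fun i _ => loss_nonneg (hWx (S i)) _)
  -- Here the complexity term is `0` even if the complexity is `⊤`, and the risk vanishes too.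
  -- Afterwards the cost is positive, so an infinite complexity makes the bound `⊤`.
  by_cases hcost : maxCost Y = 0
  · refine ⟨Set.univ, MeasurableSet.univ, by simp, fun S _ g hg => ?_⟩
    obtain ⟨h, -, rfl⟩ := hg.1
    have hrisk : risk P W hloc (fun x => softmax (h x)) = 0 := by
      simp only [risk, loss_eq_zero_of_maxCost_eq_zero (hWx _) (fun k => hloc_simplex k _) hcost,
        integral_zero]
    rw [hrisk, hcost]
    simp only [mul_zero, zero_mul, EReal.coe_zero, add_zero]
    exact EReal.coe_nonneg.2 (Real.iInf_nonneg (hemp0 S))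
  have hcostpos : 0 < maxCost Y := lt_of_le_of_ne hcost0 (Ne.symm hcost)
  have hY : Nonempty Y := by
    by_contra hY
    rw [not_nonempty_iff] at hY
    exact hcost (Real.iSup_of_isEmpty _)
  have hYcard : (1 : ℝ) ≤ Fintype.card Y := by
    exact_mod_cast Nat.one_le_iff_ne_zero.2 Fintype.card_ne_zero
  rcases Ho.eq_empty_or_nonempty with hHo | hHo
  · refine ⟨Set.univ, MeasurableSet.univ, by simp, fun S _ g hg => ?_⟩
    obtain ⟨h, hh, -⟩ := hg.1
    simp [hHo] at hh
  obtain ⟨A, hAm, hA, hdev⟩ := exists_uniform_deviation P hloc_meas hloc_simplex hW_meas hW_nonneg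
    hHo_meas hHo_sep hHo hN hδ hδ1.le hcostpos
  refine ⟨A, hAm, hA, fun S hS g hg => ?_⟩
  obtain ⟨h, hh, rfl⟩ := hg.1
  have hmin : empiricalRisk S W hloc (fun x => softmax (h x))
      ≤ ⨅ g' : globalClass Ho, empiricalRisk S W hloc g'.1 := by
    have : Nonempty (globalClass Ho) := ⟨⟨_, hg.1⟩⟩
    exact le_ciInf fun g' => hg.2 g'.1 g'.2
  by_cases htop : logitRademacher P N Ho = ⊤
  · rw [htop, EReal.coe_ennreal_top, EReal.coe_mul_top_of_pos (by positivity),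
      EReal.coe_add_top, EReal.top_add_coe]
    exact le_top
  set ρ : ℝ := (logitRademacher P N Ho).toReal with hρ
  have hrad : logitRademacher P N Ho = ENNReal.ofReal ρ := (ENNReal.ofReal_toReal htop).symm
  have hρ0 : 0 ≤ ρ := ENNReal.toReal_nonneg
  have hmain := hdev S hS h hh ρ hρ0 hrad
  rw [hrad, EReal.coe_ennreal_ofReal, max_eq_left hρ0, ← EReal.coe_mul, ← EReal.coe_add,
    ← EReal.coe_add, EReal.coe_le_coe_iff]
  have hlog : 0 ≤ Real.log (1 / δ) := Real.log_nonneg ((one_le_div hδ).2 hδ1.le)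
  have hsqrt : Real.sqrt (Real.log (1 / δ) / (2 * (N : ℝ)))
      ≤ Real.sqrt ((Fintype.card Y : ℝ) * (Real.log (1 / δ) / (2 * (N : ℝ)))) :=
    Real.sqrt_le_sqrt (le_mul_of_one_le_left (by positivity) hYcard)
  have hconf : maxCost Y * Real.sqrt (Real.log (1 / δ) / (2 * (N : ℝ)))
      ≤ 2 * maxCost Y * (Fintype.card Y : ℝ)
        * Real.sqrt ((Fintype.card Y : ℝ) * (Real.log (1 / δ) / (2 * (N : ℝ)))) := by
    -- Pure slack: `1 ≤ |Y|` enlarges both the factor and the root.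
    refine mul_le_mul ?_ hsqrt (Real.sqrt_nonneg _) (by positivity)
    nlinarith
  have hcomp : 4 * (Fintype.card Y : ℝ) * maxCost Y * ρ
      ≤ 32 * (Fintype.card Y : ℝ) * maxCost Y * ρ := by
    gcongr
    norm_num
  linarith
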